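/- Let $X$ be a complex Banach space, $\mathcal B_R=\{x\in X:\|x\|<R\}$, $\mathcal B=\mathcal B_1$, and for $x\in X$ let $J(x)=\{x^*\in X^*:\langle x,x^*\rangle=\|x\|^2=\|x^*\|^2\}$. A vector field $-h$ is called semi-complete on $\mathcal D\subset X$ if for each $x_0\in\mathcal D$ the Cauchy problem $x'(t)=h(x(t))$, $x(0)=x_0$, has a solution defined on $[0,\infty)$ with values in $\mathcal D$. Let $h:\mathcal B\to X$ be holomorphic and let $-h$ be semi-complete on $\mathcal B$. Put $$L:=\sup\{\operatorname{Re}\langle h'(0)u,u^*\rangle:\ \|u\|=1,\ u^*\in J(u)\}$$ (with $L:=0$ in the trivial case $X=\{0\}$). Then $L\le 0$, and the linear vector field $-h'(0)$ is semi-complete on $\mathcal B_R$ for every $R>0$. Suppose moreover that $$L+4\|h(0)\|<0.$$ Then the following assertions hold. (i) The equation $\|h(0)\|(1+r)^2+Lr=0$ has a smallest real root $r_1$, and $0\le r_1<1$; if $h(0)=0$ then $r_1=0$, and if $h(0)\ne0$ then $$r_1=\frac1{2\|h(0)\|}\Bigl[-(2\|h(0)\|+L)-\sqrt{(L+4\|h(0)\|)L}\Bigr].$$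 For each $r\in[r_1,1]$ the vector field $-h$ is semi-complete on $\mathcal B_r$ (with $\mathcal B_0=\emptyset$). (ii) The mapping $h$ has a unique null point $x_0$ in $\mathcal B$, and $\|x_0\|\le r_1$. (iii) For each $\lambda>0$ and each $y\in\mathcal B$ the equation $\lambda x-h(x)=\lambda y$ has a unique solution $x=\Phi_\lambda(y)$ in $\mathcal B$; the resolvent mapping $\Phi_\lambda=(\lambda I-h)^{-1}\circ(\lambda I):\mathcal B\to\mathcal B$ so defined is holomorphic, and its iterates $\Phi_\lambda^n$ converge, as $n\to\infty$, to the constant mapping with value $x_0$, uniformly on each ball $\mathcal B_\rho$, $\rho<1$. -/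

import Mathlib

noncomputable section

/-- The set `J(x)` of support functionals: all `x* ∈ X*` with
`⟨x, x*⟩ = ‖x‖² = ‖x*‖²`. -/
def dualitySet {X : Type*} [NormedAddCommGroup X] [NormedSpace ℂ X] (x : X) :
    Set (StrongDual ℂ X) :=
  {φ | φ x = ((‖x‖ ^ 2 : ℝ) : ℂ) ∧ ‖φ‖ ^ 2 = ‖x‖ ^ 2}

/-- The numerical range of `h` with respect to the ball of radius `R`:
the set of all `⟨h(x), x*⟩` with `‖x‖ = R` and `x* ∈ J(x)`. -/
def numRange {X : Type*} [NormedAddCommGroup X] [NormedSpace ℂ X] (h : X → X) (R : ℝ) :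
    Set ℂ :=
  {z | ∃ x : X, ‖x‖ = R ∧ ∃ φ ∈ dualitySet x, z = φ (h x)}

/-- `L = sup { Re ⟨h'(0) u, u*⟩ : ‖u‖ = 1, u* ∈ J(u) }`. -/
def derivNumSup {X : Type*} [NormedAddCommGroup X] [NormedSpace ℂ X] (h : X → X) : ℝ :=
  sSup (Complex.re '' numRange (fderiv ℂ h 0) 1)

/-- The real supremum defining `derivNumSup` is a genuine least upper bound. -/
theorem isLUB_derivNumSup {X : Type*} [NormedAddCommGroup X] [NormedSpace ℂ X] [Nontrivial X]
    (h : X → X) : IsLUB (Complex.re '' numRange (fderiv ℂ h 0) 1) (derivNumSup h) := by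
  apply isLUB_csSup
  · obtain ⟨u, hu⟩ := exists_norm_eq X (zero_le_one)
    obtain ⟨φ, h1, h2⟩ := exists_dual_vector ℂ u (by rw [hu]; exact one_ne_zero)
    exact ⟨_, _, ⟨u, hu, φ, ⟨by rw [h2, hu]; simp, by rw [h1, hu]⟩, rfl⟩, rfl⟩
  · refine ⟨‖fderiv ℂ h 0‖, ?_⟩
    rintro _ ⟨_, ⟨u, hu, φ, ⟨_, hφ⟩, rfl⟩, rfl⟩
    have hφ1 : ‖φ‖ = 1 := by
      rw [hu] at hφ
      nlinarith [norm_nonneg φ]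
    calc (φ (fderiv ℂ h 0 u)).re ≤ ‖φ (fderiv ℂ h 0 u)‖ := Complex.re_le_norm _
      _ ≤ ‖φ‖ * ‖fderiv ℂ h 0 u‖ := φ.le_opNorm _
      _ ≤ ‖φ‖ * (‖fderiv ℂ h 0‖ * ‖u‖) := by gcongr; exact (fderiv ℂ h 0).le_opNorm u
      _ = ‖fderiv ℂ h 0‖ := by rw [hφ1, hu]; ring

/-- `f` is a semi-complete vector field on `D`: for every `x₀ ∈ D` the Cauchy problem
`x'(t) + f(x(t)) = 0`, `x(0) = x₀`, has a solution on `[0, ∞)` with values in `D`.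
With this sign convention `-h` is semi-complete iff `x' = h(x)` is globally solvable in `D`. -/
def IsSemiComplete {X : Type*} [NormedAddCommGroup X] [NormedSpace ℂ X]
    (f : X → X) (D : Set X) : Prop :=
  ∀ x₀ ∈ D, ∃ x : ℝ → X, x 0 = x₀ ∧
    ∀ t : ℝ, 0 ≤ t → x t ∈ D ∧ HasDerivWithinAt x (-f (x t)) (Set.Ici 0) t

/-- The nonlinear resolvent `(λ I - h)⁻¹`, the inverse of `x ↦ λ x - h(x)` on the
open unit ball. -/
def nonlinearResolvent {X : Type*} [NormedAddCommGroup X] [NormedSpace ℂ X]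
    (lam : ℂ) (h : X → X) : X → X :=
  Function.invFunOn (fun x => lam • x - h x) (Metric.ball (0 : X) 1)

/-- The associated resolvent mapping `Φ_λ = (λ I - h)⁻¹ ∘ (λ I)`. -/
def resolventMap {X : Type*} [NormedAddCommGroup X] [NormedSpace ℂ X]
    (lam : ℂ) (h : X → X) : X → X :=
  fun y => nonlinearResolvent lam h (lam • y)

end

/-!
Let `F_t` be the semiflow of the field `h` on the unit ball, `L` the supremum of
`Re ⟨h'(0)u, u*⟩`, and `q(r) = ‖h(0)‖ (1 + r)² + L r`. Everything follows from two estimates.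

The first is the growth estimate `IsForwardFlow.re_le`: if `‖φ‖ ≤ 1`, `φ x = ‖x‖` and `r = ‖x‖`,
then `Re φ(h(x)) ≤ (1 - r) / (1 + r) * q(r)`. The maps `F_t` are holomorphic along holomorphic
curves (`differentiableOn_solution`), so for a unit vector `u` supported by `φ` the slice
`z ↦ φ(F_t(zu))` maps the disc into itself. The maximum principle shows that a disc map of the form
`z + t g(z)` has `g(z) = g(0) - conj (g(0)) z² - z p(z)` with `Re p ≥ 0` (`generator_re_nonneg`).
As `t → 0` the same representation is obtained for `g(z) = φ(h(zu))`, with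
`p(0) = -φ(h'(0)u)`. Hence `L ≤ 0`, and Harnack's inequality for `p` gives the estimate.

The second is that `h` is bounded on strictly smaller balls (`IsForwardFlow.exists_norm_le`), which
is not automatic in infinite dimension. The difference quotients `(F_t - I) / t` are bounded for
each `t`, and their numerical ranges are bounded uniformly in small `t`, again by Harnack's
inequality. A bound on the numerical range alone controls the norm (`norm_le_of_numRange_le`), so
the difference quotients are bounded uniformly in `t`, and so is their limit `h`.

Invariance of the balls follows from the growth estimate and a barrier argument
(`norm_lt_of_barrier`); the same barrier shows that `exp(t h'(0))` is contractive, since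
`Re φ(h'(0)u) ≤ 0`. For the null point and the resolvent, the field `f(x) = h(x) - λ (x - y)` is bounded and points strictly inwards near suitable
spheres, since `q < 0` on `(r₁, 1]`. A short Euler step `I + s f` therefore maps a ball strictly
inside itself, and the Earle–Hamilton theorem (`exists_fixedPoint_of_mapsTo_smaller_ball`) provides
the unique null point of `f` together with the invertibility of `f'` there. The inverse function
theorem then makes the resolvent mapping holomorphic, and since it maps balls strictly inside
themselves, the Earle–Hamilton theorem also gives the convergence of its iterates.
-/

open Metric Set Filter Topology
open scoped ComplexConjugate

/-! ### Functions on the unit disc with nonnegative real part -/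

/-- For a holomorphic self-map `f` of the disc, `p(z) = (f(0) - conj (f(0)) z² + z - f(z)) / z` has
nonnegative real part. On a circle of radius `r` one has `Re p ≥ 1 + r - 2 / r`, which tends to `0`
as `r → 1`; the maximum principle for `exp (-p)` carries the bound inside. -/
theorem one_sub_dslope_re_nonneg {f : ℂ → ℂ} (hf : DifferentiableOn ℂ f (ball 0 1))
    (hb : ∀ z ∈ ball (0 : ℂ) 1, ‖f z‖ ≤ 1) {z : ℂ} (hz : z ∈ ball (0 : ℂ) 1) :
    0 ≤ (1 - conj (f 0) * z - dslope f 0 z).re := by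
  set p : ℂ → ℂ := fun w => 1 - conj (f 0) * w - dslope f 0 w with hp
  have hds : DifferentiableOn ℂ (dslope f 0) (ball 0 1) :=
    (Complex.differentiableOn_dslope (ball_mem_nhds _ one_pos)).2 hf
  have hpd : DifferentiableOn ℂ p (ball 0 1) := by
    intro w hw
    exact (((differentiableWithinAt_const _).sub
      ((differentiableWithinAt_const _).mul differentiableWithinAt_id)).sub (hds w hw))
  have hz1 : ‖z‖ < 1 := by simpa using hz
  have key : ∀ r ∈ Ioo ‖z‖ 1, 1 + r - 2 / r ≤ (p z).re := by
    rintro r ⟨hr0, hr1⟩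
    have hrpos : 0 < r := (norm_nonneg z).trans_lt hr0
    have hd : DiffContOnCl ℂ (fun w => Complex.exp (-p w)) (ball 0 r) := by
      apply DifferentiableOn.diffContOnCl
      rw [closure_ball _ hrpos.ne']
      exact ((hpd.mono (closedBall_subset_ball hr1)).neg).cexp
    have hbd : ∀ w ∈ frontier (ball (0 : ℂ) r),
        ‖Complex.exp (-p w)‖ ≤ Real.exp (-(1 + r - 2 / r)) := by
      intro w hw
      rw [frontier_ball _ hrpos.ne'] at hw
      have hwr : ‖w‖ = r := by simpa using hw
      have hw0 : w ≠ 0 := by rintro rfl; simp at hwr; exact hrpos.ne hwr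
      rw [Complex.norm_exp]
      apply Real.exp_le_exp.2
      simp only [Complex.neg_re, neg_le_neg_iff, hp]
      rw [dslope_of_ne _ hw0, slope_def_field, sub_zero]
      have e1 : (f w - f 0) / w = (f w - f 0) * conj w / ((r ^ 2 : ℝ) : ℂ) := by
        have : w * conj w = ((r ^ 2 : ℝ) : ℂ) := by
          rw [Complex.mul_conj, Complex.normSq_eq_norm_sq, hwr]
        rw [← this]
        have hc : conj w ≠ 0 := by simpa using hw0
        field_simp
      rw [e1, Complex.sub_re, Complex.sub_re, Complex.div_ofReal_re]
      have e2 : (conj (f 0) * w).re = (f 0 * conj w).re := by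
        simp [Complex.mul_re]
      rw [e2, sub_mul, Complex.sub_re]
      have hs : -r ≤ (f 0 * conj w).re := by
        have := Complex.abs_re_le_norm (f 0 * conj w)
        rw [norm_mul, RCLike.norm_conj, hwr] at this
        have h0 := hb 0 (by simp)
        have := (abs_le.1 this).1
        nlinarith
      have hs2 : (f w * conj w).re ≤ r := by
        have := Complex.re_le_norm (f w * conj w)
        rw [norm_mul, RCLike.norm_conj, hwr] at this
        have h0 := hb w (by simpa [hwr] using hr1)
        nlinarith
      set s := (f 0 * conj w).re
      set m := (f w * conj w).re
      have hr2 : r ^ 2 < 1 := by nlinarith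
      have : 1 - s - (m - s) / r ^ 2 - (1 + r - 2 / r)
          = ((s + r) * (1 - r ^ 2) + (r - m)) / r ^ 2 := by
        field_simp; ring
      have h3 : 0 ≤ ((s + r) * (1 - r ^ 2) + (r - m)) / r ^ 2 := by
        apply div_nonneg _ (by positivity)
        have := mul_nonneg (by linarith : 0 ≤ s + r) (by linarith : 0 ≤ 1 - r ^ 2)
        linarith
      simp only [Complex.one_re]
      linarith
    have := Complex.norm_le_of_forall_mem_frontier_norm_le isBounded_ball hd hbd
      (subset_closure (by simpa using hr0 : z ∈ ball (0 : ℂ) r))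
    rw [Complex.norm_exp, Real.exp_le_exp, Complex.neg_re] at this
    linarith
  have hlim : Tendsto (fun r : ℝ => 1 + r - 2 / r) (𝓝[<] 1) (𝓝 (1 + 1 - 2 / 1)) := by
    apply Tendsto.mono_left _ nhdsWithin_le_nhds
    apply ContinuousAt.tendsto
    fun_prop (disch := norm_num)
  have h0 : (0 : ℝ) = 1 + 1 - 2 / 1 := by norm_num
  rw [h0]
  exact le_of_tendsto hlim (by
    filter_upwards [Ioo_mem_nhdsLT hz1] with r hr using key r hr)

/-- Harnack's inequality (lower bound) for holomorphic functions with nonnegative real part. -/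
theorem harnack_re_lower {p : ℂ → ℂ} (hp : DifferentiableOn ℂ p (ball 0 1))
    (h0 : ∀ z ∈ ball (0 : ℂ) 1, 0 ≤ (p z).re) {z : ℂ} (hz : z ∈ ball (0 : ℂ) 1) :
    (p 0).re * ((1 - ‖z‖) / (1 + ‖z‖)) ≤ (p z).re := by
  have hz1 : ‖z‖ < 1 := by simpa using hz
  rcases (h0 0 (by simp)).eq_or_lt with h | h
  · rw [← h, zero_mul]; exact h0 z hz
  have hne : ∀ w ∈ ball (0 : ℂ) 1, p w + conj (p 0) ≠ 0 := by
    intro w hw hc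
    have := congrArg Complex.re hc
    simp at this
    linarith [h0 w hw]
  have hle : ∀ w ∈ ball (0 : ℂ) 1, ‖p w - p 0‖ ≤ ‖p w + conj (p 0)‖ := by
    intro w hw
    rw [← sq_le_sq₀ (norm_nonneg _) (norm_nonneg _), Complex.sq_norm, Complex.sq_norm,
      Complex.normSq_apply, Complex.normSq_apply]
    simp only [Complex.sub_re, Complex.sub_im, Complex.add_re, Complex.add_im, Complex.conj_re,
      Complex.conj_im]
    nlinarith [mul_nonneg (h0 w hw) h.le]
  have hs := Complex.dist_le_div_mul_dist_of_mapsTo_ball (R₁ := 1) (R₂ := 1) (c := 0) (z := z)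
    (f := fun w => (p w - p 0) / (p w + conj (p 0)))
    ((hp.sub_const _).fun_div (hp.add_const _) hne) (by
      intro w hw
      have := hle w hw
      simp only [sub_self, zero_div, mem_closedBall, dist_zero_right, norm_div]
      exact div_le_one_of_le₀ this (norm_nonneg _)) hz
  simp only [sub_self, zero_div, dist_zero_right, norm_div, div_one, one_mul] at hs
  rw [div_le_iff₀ (norm_pos_iff.2 (hne z hz)), ← sq_le_sq₀ (norm_nonneg _) (by positivity),
    mul_pow, Complex.sq_norm (p z - p 0), Complex.sq_norm (p z + _), Complex.normSq_apply,
    Complex.normSq_apply] at hs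
  simp only [Complex.sub_re, Complex.sub_im, Complex.add_re, Complex.add_im, Complex.conj_re,
      Complex.conj_im] at hs
  set r := ‖z‖
  have hr : 0 ≤ r := norm_nonneg z
  have hx := h0 z hz
  have h1 : ((p z).re - (p 0).re) ^ 2 ≤ (r * ((p z).re + (p 0).re)) ^ 2 := by
    have : r ^ 2 ≤ 1 := by nlinarith
    nlinarith [mul_nonneg (sub_nonneg.2 this) (sq_nonneg ((p z).im - (p 0).im))]
  have h2 := abs_le_of_sq_le_sq h1 (by positivity)
  have h3 := (abs_le.1 h2).1
  rw [← mul_div_assoc, div_le_iff₀ (by linarith)]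
  linarith

/-- Harnack's inequality (upper bound for the modulus) for holomorphic functions with nonnegative
real part. -/
theorem harnack_norm_upper {p : ℂ → ℂ} (hp : DifferentiableOn ℂ p (ball 0 1))
    (h0 : ∀ z ∈ ball (0 : ℂ) 1, 0 ≤ (p z).re) {z : ℂ} (hz : z ∈ ball (0 : ℂ) 1) :
    ‖p z‖ ≤ ‖p 0‖ * (1 + ‖z‖) / (1 - ‖z‖) := by
  have hlim : Tendsto (fun M : ℝ => 2 * M * ‖z‖ / (1 - ‖z‖) + ‖p 0‖ * (1 + ‖z‖) / (1 - ‖z‖))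
      (𝓝[>] 0) (𝓝 (2 * 0 * ‖z‖ / (1 - ‖z‖) + ‖p 0‖ * (1 + ‖z‖) / (1 - ‖z‖))) := by
    apply Tendsto.mono_left _ nhdsWithin_le_nhds
    apply Continuous.tendsto
    fun_prop
  simp only [mul_zero, zero_mul, zero_div, zero_add] at hlim
  refine ge_of_tendsto hlim ?_
  filter_upwards [self_mem_nhdsWithin] with M hM
  have := Complex.borelCaratheodory (f := fun w => -p w) (M := M) (R := 1) hM hp.fun_neg (by
    intro w hw
    have := h0 w hw
    have hM' : (0 : ℝ) < M := hM
    show (-p w).re ≤ M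
    rw [Complex.neg_re]; linarith) one_pos hz
  simpa using this

/-! ### A barrier principle for curves in a normed space -/

/-- The norm of a curve stays strictly below a barrier `b` if, at any contact, some functional
supporting the curve grows more slowly than `b`. At the first contact the support functional bounds
the norm from below at earlier times, so that one support functional at each contact suffices. -/
theorem norm_lt_of_barrier {X : Type*} [NormedAddCommGroup X] [NormedSpace ℂ X]
    {x v : ℝ → X} {b b' : ℝ → ℝ} {T : ℝ}
    (hx : ∀ t ∈ Icc 0 T, HasDerivWithinAt x (v t) (Icc 0 T) t)
    (hb : ∀ t ∈ Icc 0 T, HasDerivWithinAt b (b' t) (Icc 0 T) t)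
    (h0 : ‖x 0‖ < b 0)
    (hv : ∀ t ∈ Ioc 0 T, ‖x t‖ = b t →
      ∃ φ : StrongDual ℂ X, ‖φ‖ ≤ 1 ∧ φ (x t) = ‖x t‖ ∧ (φ (v t)).re < b' t) :
    ∀ t ∈ Icc 0 T, ‖x t‖ < b t := by
  by_contra! hcon
  have hcx : ContinuousOn x (Icc 0 T) := fun t ht => (hx t ht).continuousWithinAt
  have hcb : ContinuousOn b (Icc 0 T) := fun t ht => (hb t ht).continuousWithinAt
  set S : Set ℝ := Icc 0 T ∩ {t | b t ≤ ‖x t‖} with hS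
  have hSc : IsClosed S := isClosed_Icc.isClosed_le hcb hcx.norm
  have hSne : S.Nonempty := by obtain ⟨t, ht, h⟩ := hcon; exact ⟨t, ht, h⟩
  have hSb : BddBelow S := ⟨0, fun t ht => ht.1.1⟩
  set s := sInf S
  have hsS : s ∈ S := hSc.csInf_mem hSne hSb
  have hlt : ∀ t ∈ Ico 0 s, ‖x t‖ < b t := by
    intro t ht
    by_contra! h
    exact absurd (csInf_le hSb (show t ∈ S from ⟨⟨ht.1, ht.2.le.trans hsS.1.2⟩, h⟩))
      (not_le.2 ht.2)
  have hspos : 0 < s := by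
    rcases hsS.1.1.eq_or_lt with h | h
    · have := hsS.2
      rw [← h] at this
      exact absurd h0 (not_lt.2 this)
    · exact h
  have hsub : Ico 0 s ⊆ Icc 0 T := fun t ht => ⟨ht.1, ht.2.le.trans hsS.1.2⟩
  have : (𝓝[Ico 0 s] s).NeBot := by
    rw [← mem_closure_iff_nhdsWithin_neBot, closure_Ico hspos.ne]
    exact ⟨hspos.le, le_rfl⟩
  have heq : ‖x s‖ = b s := by
    apply le_antisymm _ hsS.2
    exact le_of_tendsto_of_tendsto (((hcx s hsS.1).mono hsub).norm) ((hcb s hsS.1).mono hsub)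
      (by filter_upwards [self_mem_nhdsWithin] with t ht using (hlt t ht).le)
  obtain ⟨φ, hφ1, hφx, hφv⟩ := hv s ⟨hspos, hsS.1.2⟩ heq
  have hd : HasDerivWithinAt (fun t => (φ (x t)).re - b t) ((φ (v s)).re - b' s) (Ico 0 s) s := by
    have h1 := ((Complex.reCLM.comp (φ.restrictScalars ℝ)).hasFDerivAt.comp_hasDerivWithinAt s
      (hx s hsS.1)).sub (hb s hsS.1)
    exact h1.mono hsub
  rw [hasDerivWithinAt_iff_tendsto_slope' (by simp)] at hd
  have : 0 ≤ (φ (v s)).re - b' s := by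
    refine ge_of_tendsto hd ?_
    filter_upwards [self_mem_nhdsWithin] with t ht
    rw [slope_def_field, hφx, Complex.ofReal_re, heq, sub_self, sub_zero]
    have h1 : (φ (x t)).re ≤ ‖x t‖ := by
      calc (φ (x t)).re ≤ ‖φ (x t)‖ := Complex.re_le_norm _
        _ ≤ ‖φ‖ * ‖x t‖ := φ.le_opNorm _
        _ ≤ 1 * ‖x t‖ := by gcongr
        _ = ‖x t‖ := one_mul _
    exact div_nonneg_of_nonpos (by linarith [hlt t ht]) (by linarith [ht.2])
  linarith

/-! ### Maps that are holomorphic along holomorphic curves -/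

/-- `H` is holomorphic along every holomorphic curve (one complex variable) lying in `D`. This is
weaker than Fréchet holomorphy, but it is stable under Euler steps and is what the limits of Euler
polygons inherit from the one-variable theory of locally uniform limits. -/
def HolomorphicAlongCurves {X Y : Type*} [NormedAddCommGroup X] [NormedSpace ℂ X]
    [NormedAddCommGroup Y] [NormedSpace ℂ Y] (H : X → Y) (D : Set X) : Prop :=
  ∀ (U : Set ℂ) (c : ℂ → X), IsOpen U → DifferentiableOn ℂ c U → MapsTo c U D →
    DifferentiableOn ℂ (fun z => H (c z)) U

section

variable {X Y : Type*} [NormedAddCommGroup X] [NormedSpace ℂ X]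
  [NormedAddCommGroup Y] [NormedSpace ℂ Y]

theorem DifferentiableOn.holomorphicAlongCurves {H : X → Y} {D : Set X}
    (hH : DifferentiableOn ℂ H D) : HolomorphicAlongCurves H D :=
  fun _ _ _ hc hm => hH.comp hc hm

theorem HolomorphicAlongCurves.mono {H : X → Y} {D D' : Set X}
    (hH : HolomorphicAlongCurves H D) (hD : D' ⊆ D) : HolomorphicAlongCurves H D' :=
  fun U c hU hc hm => hH U c hU hc (hm.mono_right hD)

/-- A bounded map that is holomorphic along curves is Lipschitz on smaller balls, by the Schwarz
lemma on complex lines. -/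
theorem HolomorphicAlongCurves.norm_sub_le {H : X → Y} {y : X} {R r M : ℝ}
    (hH : HolomorphicAlongCurves H (ball y R)) (hr : r < R)
    (hM : ∀ x ∈ ball y R, ‖H x‖ ≤ M) {x x' : X} (hx : x ∈ ball y r) (hx' : x' ∈ ball y r) :
    ‖H x' - H x‖ ≤ 2 * M / (R - r) * ‖x' - x‖ := by
  have hsub : ball y r ⊆ ball y R := ball_subset_ball hr.le
  have hd : 0 < R - r := sub_pos.2 hr
  have hM0 : 0 ≤ M := (norm_nonneg _).trans (hM x (hsub hx))
  have h2M : ∀ w ∈ ball y R, ‖H w - H x‖ ≤ 2 * M := by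
    intro w hw
    linarith [_root_.norm_sub_le (H w) (H x), hM w hw, hM x (hsub hx)]
  rcases le_or_gt (R - r) ‖x' - x‖ with h | h
  · calc ‖H x' - H x‖ ≤ 2 * M := h2M x' (hsub hx')
      _ = 2 * M / (R - r) * (R - r) := by field_simp
      _ ≤ _ := by gcongr
  · rcases eq_or_ne x' x with rfl | hne
    · simp
    have hp : 0 < ‖x' - x‖ := norm_pos_iff.2 (sub_ne_zero.2 hne)
    have hmaps : MapsTo (fun ζ : ℂ => x + ζ • (x' - x)) (ball 0 ((R - r) / ‖x' - x‖))
        (ball y R) := by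
      intro ζ hζ
      rw [mem_ball_zero_iff, lt_div_iff₀ hp] at hζ
      rw [mem_ball_iff_norm] at hx ⊢
      calc ‖x + ζ • (x' - x) - y‖ = ‖(x - y) + ζ • (x' - x)‖ := by congr 1; abel
        _ ≤ ‖x - y‖ + ‖ζ‖ * ‖x' - x‖ := by rw [← norm_smul]; exact norm_add_le _ _
        _ < R := by linarith
    have hdiff := hH _ (fun ζ : ℂ => x + ζ • (x' - x)) isOpen_ball
      (by fun_prop) hmaps
    have := Complex.dist_le_div_mul_dist_of_mapsTo_ball (z := 1) (R₂ := 2 * M) hdiff (by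
      intro ζ hζ
      have := h2M _ (hmaps hζ)
      simpa [dist_eq_norm] using this) (by simpa [one_lt_div hp] using h)
    simp only [one_smul, add_sub_cancel, zero_smul, add_zero, dist_eq_norm, sub_zero,
      norm_one, mul_one] at this
    calc ‖H x' - H x‖ ≤ _ := this
      _ = _ := by field_simp

theorem DifferentiableOn.exists_ball_norm_le_lipschitz {h : X → Y} {U : Set X} (hU : IsOpen U)
    (hh : DifferentiableOn ℂ h U) {y : X} (hy : y ∈ U) :
    ∃ δ > 0, ∃ M > 0, ∃ K > 0, ball y δ ⊆ U ∧ (∀ x ∈ ball y δ, ‖h x‖ ≤ M) ∧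
      ∀ x ∈ ball y δ, ∀ x' ∈ ball y δ, ‖h x' - h x‖ ≤ K * ‖x' - x‖ := by
  have hc : ContinuousAt h y := (hh.differentiableAt (hU.mem_nhds hy)).continuousAt
  have h1 : ∀ᶠ x in 𝓝 y, x ∈ U ∧ ‖h x‖ < ‖h y‖ + 1 :=
    Filter.Eventually.and (hU.mem_nhds hy) (hc.norm.eventually_lt continuousAt_const (by simp))
  obtain ⟨R, hR, hball⟩ := Metric.eventually_nhds_iff_ball.1 h1
  have hM : 0 < ‖h y‖ + 1 := by positivity
  refine ⟨R / 2, half_pos hR, ‖h y‖ + 1, hM, 2 * (‖h y‖ + 1) / (R - R / 2),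
    div_pos (by linarith) (by linarith),
    fun x hx => (hball x (ball_subset_ball (by linarith) hx)).1,
    fun x hx => (hball x (ball_subset_ball (by linarith) hx)).2.le, fun x hx x' hx' => ?_⟩
  exact ((hh.mono fun x hx => (hball x hx).1).holomorphicAlongCurves).norm_sub_le
    (by linarith) (fun x hx => (hball x hx).2.le) hx hx'

/-! ### Euler polygons and holomorphic dependence on initial values -/

/-- Error bound for the explicit Euler scheme with step `Δ`. -/
theorem norm_euler_sub_le {h : X → X} {D : Set X} {M K : ℝ} (hM0 : 0 ≤ M) (hK0 : 0 ≤ K)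
    (hM : ∀ x ∈ D, ‖h x‖ ≤ M) (hK : ∀ x ∈ D, ∀ x' ∈ D, ‖h x' - h x‖ ≤ K * ‖x' - x‖)
    {x : ℝ → X} {Δ : ℝ} (hΔ : 0 ≤ Δ) {n : ℕ}
    (hx : ∀ t ∈ Icc 0 (n * Δ), x t ∈ D ∧ HasDerivWithinAt x (h (x t)) (Icc 0 (n * Δ)) t)
    {E : ℕ → X} (hE0 : E 0 = x 0) (hE : ∀ k < n, E (k + 1) = E k + Δ • h (E k))
    (hED : ∀ k ≤ n, E k ∈ D) :
    ∀ k ≤ n, ‖E k - x (k * Δ)‖ ≤ (1 + K * Δ) ^ k * (k * (K * M * Δ ^ 2)) := by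
  intro k
  induction k with
  | zero => intro _; simp [hE0]
  | succ k ih =>
    intro hk
    have hkn : k < n := hk
    have ih := ih hkn.le
    have hkn' : (k : ℝ) + 1 ≤ n := by exact_mod_cast hk
    have hsub : Icc (k * Δ) ((k + 1) * Δ) ⊆ Icc 0 (n * Δ) := by
      apply Icc_subset_Icc (by positivity)
      gcongr
    have hle : k * Δ ≤ (k + 1) * Δ := by nlinarith
    have hmem : (k * Δ) ∈ Icc (k * Δ) ((k + 1) * Δ) := ⟨le_rfl, hle⟩
    have hlip : ∀ t ∈ Icc (k * Δ) ((k + 1) * Δ), ‖x t - x (k * Δ)‖ ≤ M * Δ := by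
      intro t ht
      have := (convex_Icc (k * Δ) ((k + 1) * Δ)).norm_image_sub_le_of_norm_hasDerivWithin_le
        (fun t ht => (hx t (hsub ht)).2.mono hsub) (fun t ht => hM _ (hx t (hsub ht)).1) hmem ht
      refine this.trans ?_
      rw [Real.norm_eq_abs, abs_of_nonneg (by linarith [ht.1])]
      gcongr
      linarith [ht.2]
    -- local truncation error
    have htr : ‖x ((k + 1) * Δ) - x (k * Δ) - Δ • h (x (k * Δ))‖ ≤ K * (M * Δ) * Δ := by
      have := (convex_Icc (k * Δ) ((k + 1) * Δ)).norm_image_sub_le_of_norm_hasDerivWithin_le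
        (f := fun t => x t - t • h (x (k * Δ))) (C := K * (M * Δ))
        (fun t ht => ((hx t (hsub ht)).2.mono hsub).sub
          ((hasDerivWithinAt_id t _).smul_const (h (x (k * Δ)))))
        (fun t ht => by
          rw [one_smul]
          exact (hK _ (hx _ (hsub hmem)).1 _ (hx _ (hsub ht)).1).trans
            (by gcongr; exact hlip t ht)) hmem ⟨hle, le_rfl⟩
      rw [Real.norm_eq_abs, abs_of_nonneg (by linarith)] at this
      have e : ((k : ℝ) + 1) * Δ - k * Δ = Δ := by ring
      rw [e] at this
      convert this using 2
      rw [add_mul, one_mul, add_smul]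
      abel
    have hstep : ‖E (k + 1) - x ((k + 1) * Δ)‖
        ≤ (1 + K * Δ) * ‖E k - x (k * Δ)‖ + K * (M * Δ) * Δ := by
      have e : E (k + 1) - x ((k + 1) * Δ) = (E k - x (k * Δ)) +
          Δ • (h (E k) - h (x (k * Δ))) -
          (x ((k + 1) * Δ) - x (k * Δ) - Δ • h (x (k * Δ))) := by
        rw [hE k hkn, smul_sub]; abel
      rw [e]
      calc _ ≤ ‖E k - x (k * Δ)‖ + ‖Δ • (h (E k) - h (x (k * Δ)))‖ + K * (M * Δ) * Δ := by
            refine (norm_sub_le _ _).trans (add_le_add (norm_add_le _ _) htr)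
        _ ≤ ‖E k - x (k * Δ)‖ + Δ * (K * ‖E k - x (k * Δ)‖) + K * (M * Δ) * Δ := by
            rw [norm_smul, Real.norm_eq_abs, abs_of_nonneg hΔ]
            gcongr
            exact hK _ (hx _ (hsub hmem)).1 _ (hED k hkn.le)
        _ = _ := by ring
    have h1 : 1 ≤ (1 + K * Δ) ^ (k + 1) := one_le_pow₀ (by nlinarith [mul_nonneg hK0 hΔ])
    push_cast
    calc ‖E (k + 1) - x ((k + 1) * Δ)‖ ≤ _ := hstep
      _ ≤ (1 + K * Δ) * ((1 + K * Δ) ^ k * (k * (K * M * Δ ^ 2))) + 1 * (K * M * Δ ^ 2) := by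
        have : 0 ≤ 1 + K * Δ := by positivity
        have e : K * (M * Δ) * Δ = 1 * (K * M * Δ ^ 2) := by ring
        rw [e]; gcongr
      _ ≤ (1 + K * Δ) * ((1 + K * Δ) ^ k * (k * (K * M * Δ ^ 2))) +
          (1 + K * Δ) ^ (k + 1) * (K * M * Δ ^ 2) := by gcongr
      _ = _ := by ring

/-- A solution that starts in a ball of radius `δ` on whose double the field is bounded by `M`
stays in the double ball up to each time `s < δ / M`. -/
theorem solution_mem_ball {h : X → X} {y : X} {δ M s : ℝ} (hs : 0 < s) (hsM : s * M < δ)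
    (hM : ∀ x ∈ ball y (2 * δ), ‖h x‖ ≤ M) (hδ : 0 < δ) {x : ℝ → X}
    (hx : ∀ t ∈ Icc 0 s, HasDerivWithinAt x (h (x t)) (Icc 0 s) t) (h0 : x 0 ∈ ball y δ) :
    ∀ t ∈ Icc 0 s, x t ∈ ball y (2 * δ) := by
  -- a barrier speed strictly between `M` and `δ / s` keeps the curve inside up to time `s`
  obtain ⟨m, hm1, hm2⟩ := exists_between ((lt_div_iff₀ hs).2 (by linarith : M * s < δ))
  have hms : m * s < δ := (lt_div_iff₀ hs).1 hm2
  have hm0 : 0 ≤ m := ((norm_nonneg _).trans (hM y (by simpa using hδ))).trans hm1.le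
  have hb2 : ∀ t ∈ Icc 0 s, δ + t * m < 2 * δ := by
    intro t ht
    nlinarith [mul_le_mul_of_nonneg_right ht.2 hm0]
  intro t ht
  rw [mem_ball_iff_norm]
  refine (norm_lt_of_barrier (x := fun t => x t - y) (v := fun t => h (x t))
    (b := fun t => δ + t * m) (b' := fun _ => m) (T := s)
    (fun t ht => (hx t ht).sub_const y)
    (fun t _ => by simpa using ((hasDerivWithinAt_id t _).mul_const m).const_add δ)
    (by simpa [dist_eq_norm] using h0) ?_ t ht).trans (hb2 t ht)
  intro t ht he
  obtain ⟨φ, hφ, hφx⟩ := exists_dual_vector'' ℂ (x t - y)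
  refine ⟨φ, hφ, hφx, ?_⟩
  have hm : x t ∈ ball y (2 * δ) := by
    rw [mem_ball_iff_norm, he]
    exact hb2 t (Ioc_subset_Icc_self ht)
  calc (φ (h (x t))).re ≤ ‖φ (h (x t))‖ := Complex.re_le_norm _
    _ ≤ ‖φ‖ * ‖h (x t)‖ := φ.le_opNorm _
    _ ≤ 1 * M := by gcongr; exact hM _ hm
    _ < m := by linarith

theorem norm_solution_sub_le {h : X → X} {y : X} {δ M s : ℝ} (hs : 0 ≤ s) (hsM : s * M < δ)
    (hM : ∀ x ∈ ball y (2 * δ), ‖h x‖ ≤ M) (hδ : 0 < δ) {x : ℝ → X}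
    (hx : ∀ t ∈ Icc 0 s, HasDerivWithinAt x (h (x t)) (Icc 0 s) t) (h0 : x 0 ∈ ball y δ) :
    ‖x s - x 0‖ ≤ M * s := by
  rcases hs.eq_or_lt with rfl | hs'
  · simp
  have := (convex_Icc 0 s).norm_image_sub_le_of_norm_hasDerivWithin_le hx
    (fun u hu => hM _ (solution_mem_ball hs' hsM hM hδ hx h0 u hu))
    (left_mem_Icc.2 hs) (right_mem_Icc.2 hs)
  simpa [abs_of_nonneg hs] using this

/-- Short-time holomorphic dependence on initial values: Euler polygons depend holomorphically on
the parameter and converge uniformly to the solutions. -/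
theorem differentiableOn_solution_of_short_time [CompleteSpace X] {h : X → X} {y : X} {δ M K s : ℝ} (hs : 0 < s)
    (hsM : s * M < δ) (hδ : 0 < δ) (hK0 : 0 ≤ K) (hh : DifferentiableOn ℂ h (ball y (2 * δ)))
    (hM : ∀ x ∈ ball y (2 * δ), ‖h x‖ ≤ M)
    (hK : ∀ x ∈ ball y (2 * δ), ∀ x' ∈ ball y (2 * δ), ‖h x' - h x‖ ≤ K * ‖x' - x‖)
    {V : Set ℂ} (hV : IsOpen V) {x : ℂ → ℝ → X}
    (hx : ∀ z ∈ V, ∀ t ∈ Icc 0 s, HasDerivWithinAt (x z) (h (x z t)) (Icc 0 s) t)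
    (h0 : ∀ z ∈ V, x z 0 ∈ ball y δ) (h0d : DifferentiableOn ℂ (fun z => x z 0) V) :
    DifferentiableOn ℂ (fun z => x z s) V := by
  have hM0 : 0 ≤ M := (norm_nonneg _).trans (hM y (by simpa using hδ))
  set E : ℝ → ℕ → ℂ → X := fun Δ k z => (fun w => w + Δ • h w)^[k] (x z 0) with hE
  have hEsucc : ∀ Δ k z, E Δ (k + 1) z = E Δ k z + Δ • h (E Δ k z) := by
    intro Δ k z
    simp only [hE, Function.iterate_succ_apply']
  have hEball : ∀ Δ : ℝ, 0 ≤ Δ → ∀ n : ℕ, n * Δ = s → ∀ k ≤ n, ∀ z ∈ V,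
      ‖E Δ k z - x z 0‖ ≤ k * (Δ * M) ∧ E Δ k z ∈ ball y (2 * δ) := by
    intro Δ hΔ n hn k
    induction k with
    | zero =>
      intro _ z hz
      refine ⟨by simp [hE], ball_subset_ball (by linarith) (h0 z hz)⟩
    | succ k ih =>
      intro hk z hz
      obtain ⟨h1, h2⟩ := ih (by omega) z hz
      have hkn' : (k : ℝ) + 1 ≤ n := by exact_mod_cast hk
      have h3 : ‖E Δ (k + 1) z - x z 0‖ ≤ ((k + 1 : ℕ) : ℝ) * (Δ * M) := by
        rw [hEsucc]
        calc _ = ‖(E Δ k z - x z 0) + Δ • h (E Δ k z)‖ := by congr 1; abel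
          _ ≤ k * (Δ * M) + Δ * M := by
            refine (norm_add_le _ _).trans (add_le_add h1 ?_)
            rw [norm_smul, Real.norm_eq_abs, abs_of_nonneg hΔ]
            gcongr
            exact hM _ h2
          _ = _ := by push_cast; ring
      refine ⟨h3, ?_⟩
      have h4 : ((k + 1 : ℕ) : ℝ) * (Δ * M) ≤ s * M := by
        rw [← hn]; push_cast
        have := mul_le_mul_of_nonneg_right hkn' (mul_nonneg hΔ hM0)
        linarith
      have h5 := h0 z hz
      rw [mem_ball_iff_norm] at h5 ⊢
      calc _ = ‖(E Δ (k + 1) z - x z 0) + (x z 0 - y)‖ := by congr 1; abel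
        _ ≤ _ := norm_add_le _ _
        _ < 2 * δ := by linarith
  have hEd : ∀ Δ : ℝ, 0 ≤ Δ → ∀ n : ℕ, n * Δ = s → ∀ k ≤ n, DifferentiableOn ℂ (E Δ k) V := by
    intro Δ hΔ n hn k
    induction k with
    | zero => intro _; exact h0d
    | succ k ih =>
      intro hk
      have h1 := ih (by omega)
      have h2 : DifferentiableOn ℂ (fun z => h (E Δ k z)) V :=
        hh.comp h1 fun z hz => (hEball Δ hΔ n hn k (by omega) z hz).2
      exact (h1.add (h2.const_smul Δ)).congr fun z _ => hEsucc Δ k z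
  have hstep : ∀ n : ℕ, ((n + 1 : ℕ) : ℝ) * (s / (n + 1 : ℕ)) = s := fun n => by
    field_simp
  have hbound : ∀ n : ℕ, ∀ z ∈ V, ‖E (s / (n + 1 : ℕ)) (n + 1) z - x z s‖ ≤
      Real.exp (K * s) * (K * M * s ^ 2) / (n + 1 : ℕ) := by
    intro n z hz
    have hΔ : 0 ≤ s / (n + 1 : ℕ) := by positivity
    have := norm_euler_sub_le hM0 hK0 hM hK hΔ (n := n + 1) (x := x z)
      (E := fun k => E (s / (n + 1 : ℕ)) k z) (by
        rw [hstep]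
        exact fun t ht => ⟨solution_mem_ball hs hsM hM hδ (hx z hz) (h0 z hz) t ht,
          hx z hz t ht⟩) rfl (fun k _ => hEsucc _ k z)
      (fun k hk => (hEball _ hΔ _ (hstep n) k hk z hz).2) (n + 1) le_rfl
    rw [hstep] at this
    refine this.trans ?_
    have h1 : (1 + K * (s / (n + 1 : ℕ))) ^ (n + 1) ≤ Real.exp (K * s) := by
      calc _ ≤ (Real.exp (K * (s / (n + 1 : ℕ)))) ^ (n + 1) := by
            gcongr; linarith [Real.add_one_le_exp (K * (s / (n + 1 : ℕ)))]
        _ = _ := by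
          rw [← Real.exp_nat_mul]; congr 1
          rw [mul_left_comm, hstep]
    have h2 : ((n + 1 : ℕ) : ℝ) * (K * M * (s / (n + 1 : ℕ)) ^ 2)
        = (K * M * s ^ 2) / (n + 1 : ℕ) := by field_simp
    calc _ ≤ Real.exp (K * s) * (K * M * s ^ 2 / (n + 1 : ℕ)) := by
          rw [h2]; exact mul_le_mul_of_nonneg_right h1 (by positivity)
      _ = _ := by ring
  have hunif : TendstoUniformlyOn (fun n : ℕ => E (s / (n + 1 : ℕ)) (n + 1))
      (fun z => x z s) atTop V := by
    rw [Metric.tendstoUniformlyOn_iff]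
    intro ε hε
    have hlim : Tendsto (fun n : ℕ => Real.exp (K * s) * (K * M * s ^ 2) / (n + 1 : ℕ)) atTop
        (𝓝 0) := (tendsto_const_div_atTop_nhds_zero_nat _).comp (tendsto_add_atTop_nat 1)
    filter_upwards [hlim.eventually_lt_const hε] with n hn z hz
    rw [dist_comm, dist_eq_norm]
    exact (hbound n z hz).trans_lt hn
  exact hunif.tendstoLocallyUniformlyOn.differentiableOn
    (Eventually.of_forall fun n => hEd _ (by positivity) (n + 1) (hstep n) _ le_rfl) hV

/-- Holomorphic dependence on initial values, for an arbitrary family of global solutions. -/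
theorem differentiableOn_solution [CompleteSpace X] {h : X → X} {D : Set X} (hD : IsOpen D)
    (hh : DifferentiableOn ℂ h D) {U : Set ℂ} (hU : IsOpen U) {x : ℂ → ℝ → X}
    (hx : ∀ z ∈ U, ∀ t : ℝ, 0 ≤ t →
      x z t ∈ D ∧ HasDerivWithinAt (x z) (h (x z t)) (Ici 0) t)
    (h0d : DifferentiableOn ℂ (fun z => x z 0) U) {T : ℝ} (hT : 0 ≤ T) :
    DifferentiableOn ℂ (fun z => x z T) U := by
  intro z₀ hz₀
  set P : ℝ → Prop := fun t => ∀ᶠ z in 𝓝 z₀, DifferentiableAt ℂ (fun z => x z t) z with hP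
  suffices h : P T from h.self_of_nhds.differentiableWithinAt
  have hP0 : P 0 := by
    filter_upwards [hU.mem_nhds hz₀] with z hz using h0d.differentiableAt (hU.mem_nhds hz)
  -- holomorphy propagates for a time that is locally uniform along the solution
  have step : ∀ t : ℝ, 0 ≤ t → ∃ ε > 0, ∀ s, 0 ≤ s → |s - t| < ε → P s →
      ∀ s' ∈ Ico s (t + ε), P s' := by
    intro t ht
    obtain ⟨δ', hδ', M, hM0, K, hK0, hsub, hM, hK⟩ :=
      hh.exists_ball_norm_le_lipschitz hD (hx z₀ hz₀ t ht).1
    obtain ⟨δ, hδ, rfl⟩ : ∃ δ > 0, δ' = 2 * δ := ⟨δ' / 2, half_pos hδ', by ring⟩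
    have hc : ContinuousWithinAt (x z₀) (Ici 0) t := (hx z₀ hz₀ t ht).2.continuousWithinAt
    obtain ⟨ε₁, hε₁, hc⟩ := Metric.continuousWithinAt_iff.1 hc δ hδ
    refine ⟨min ε₁ (δ / (2 * M)), lt_min hε₁ (by positivity), ?_⟩
    intro s hs hst hPs s' hs'
    rcases hs'.1.eq_or_lt with rfl | hlt
    · exact hPs
    have hnear : ∀ᶠ z in 𝓝 z₀, x z s ∈ ball (x z₀ t) δ := by
      apply hPs.self_of_nhds.continuousAt.eventually_mem
      apply isOpen_ball.mem_nhds
      exact hc hs (hst.trans_le (min_le_left _ _))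
    have hsM : (s' - s) * M < δ := by
      have h1 := (abs_lt.1 (hst.trans_le (min_le_right _ _))).1
      have h2 : s' < t + δ / (2 * M) := hs'.2.trans_le (by gcongr; exact min_le_right _ _)
      have h3 : s' - s < 2 * (δ / (2 * M)) := by linarith
      calc (s' - s) * M < 2 * (δ / (2 * M)) * M := by gcongr
        _ = δ := by field_simp
    obtain ⟨V, hVsub, hV, hzV⟩ := _root_.eventually_nhds_iff.1
      (hPs.and (hnear.and (hU.mem_nhds hz₀)))
    have hd := differentiableOn_solution_of_short_time (s := s' - s) (by linarith) hsM hδ hK0.le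
      (hh.mono hsub) hM hK hV (x := fun z τ => x z (s + τ)) (by
        intro z hz τ hτ
        have h1 := (hx z (hVsub z hz).2.2 (s + τ) (by linarith [hτ.1])).2
        have h2 : HasDerivWithinAt (fun τ : ℝ => s + τ) 1 (Icc 0 (s' - s)) τ :=
          (hasDerivWithinAt_id τ _).const_add s
        have h3 := h1.scomp τ h2 (fun u hu => by
          have := hu.1
          show 0 ≤ s + u
          linarith)
        rw [one_smul] at h3
        exact h3) (fun z hz => by simpa using (hVsub z hz).2.1)
      (fun z hz => by simpa using (hVsub z hz).1.differentiableWithinAt)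
    simp only [add_sub_cancel] at hd
    exact _root_.eventually_nhds_iff.2 ⟨V, fun z hz => hd.differentiableAt (hV.mem_nhds hz), hV, hzV⟩
  by_contra hcon
  set A : Set ℝ := {t | 0 ≤ t ∧ ¬ P t}
  have hAne : A.Nonempty := ⟨T, hT, hcon⟩
  have hAb : BddBelow A := ⟨0, fun t ht => ht.1⟩
  have ha0 : 0 ≤ sInf A := le_csInf hAne fun t ht => ht.1
  obtain ⟨ε, hε, hstep⟩ := step (sInf A) ha0
  obtain ⟨b, hbA, hb⟩ := exists_lt_of_csInf_lt hAne (by linarith : sInf A < sInf A + ε)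
  set s := max 0 (sInf A - ε / 2) with hs
  have hsle : s ≤ sInf A := max_le ha0 (by linarith)
  have hPs : P s := by
    rcases hsle.eq_or_lt with he | hlt
    · have : s = 0 := by
        rcases max_choice 0 (sInf A - ε / 2) with h | h
        · exact h
        · rw [← hs] at h; linarith
      rw [this]; exact hP0
    · by_contra hn
      exact absurd (csInf_le hAb (show s ∈ A from ⟨le_max_left _ _, hn⟩)) (not_le.2 hlt)
  refine hbA.2 (hstep s (le_max_left _ _) ?_ hPs b ⟨hsle.trans (csInf_le hAb hbA), hb⟩)
  rw [abs_lt]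
  constructor <;> linarith [le_max_right 0 (sInf A - ε / 2)]

/-! ### One-dimensional generators -/

/-- If `z ↦ z + t g(z)` maps the disc into itself for some `t > 0`, then
`g(z) = g(0) - conj (g(0)) z² - z p(z)` with `Re p ≥ 0`. -/
theorem generator_re_nonneg {f g : ℂ → ℂ} (hf : DifferentiableOn ℂ f (ball 0 1))
    (hb : ∀ z ∈ ball (0 : ℂ) 1, ‖f z‖ ≤ 1) {t : ℝ} (ht : 0 < t)
    (hg : ∀ z, g z = (f z - z) / t) {z : ℂ} (hz : z ∈ ball (0 : ℂ) 1) :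
    0 ≤ (-(conj (g 0) * z) - dslope g 0 z).re := by
  have ht' : (t : ℂ) ≠ 0 := by exact_mod_cast ht.ne'
  have h1 := one_sub_dslope_re_nonneg hf hb hz
  have hf0 : f 0 = t * g 0 := by rw [hg]; field_simp; simp
  have hd : dslope f 0 z = 1 + t * dslope g 0 z := by
    rcases eq_or_ne z 0 with rfl | hz0
    · have h2 : HasDerivAt f (deriv f 0) 0 :=
        (hf.differentiableAt (ball_mem_nhds _ one_pos)).hasDerivAt
      have h3 : HasDerivAt g ((deriv f 0 - 1) / t) 0 :=
        ((h2.sub (hasDerivAt_id 0)).div_const (t : ℂ)).congr_of_eventuallyEq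
          (Eventually.of_forall hg)
      rw [dslope_same, dslope_same, h3.deriv]
      field_simp
      ring
    · rw [dslope_of_ne _ hz0, dslope_of_ne _ hz0, slope_def_field, slope_def_field, hg z, hg 0,
        sub_zero]
      field_simp
      ring
  rw [hd, hf0] at h1
  have h2 : 1 - conj (t * g 0) * z - (1 + t * dslope g 0 z)
      = (t : ℂ) * (-(conj (g 0) * z) - dslope g 0 z) := by
    rw [map_mul, Complex.conj_ofReal]; ring
  rw [h2, Complex.re_ofReal_mul] at h1
  exact nonneg_of_mul_nonneg_right h1 ht

/-- The function `p` attached to a one-dimensional generator `g` is holomorphic. -/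
theorem differentiableOn_generator {g : ℂ → ℂ} (hg : DifferentiableOn ℂ g (ball 0 1)) :
    DifferentiableOn ℂ (fun z => -(conj (g 0) * z) - dslope g 0 z) (ball 0 1) := by
  have hds : DifferentiableOn ℂ (dslope g 0) (ball 0 1) :=
    (Complex.differentiableOn_dslope (ball_mem_nhds _ one_pos)).2 hg
  intro w hw
  exact (((differentiableWithinAt_const _).mul differentiableWithinAt_id).neg.sub (hds w hw))

theorem eq_add_mul_dslope (g : ℂ → ℂ) (z : ℂ) : g z = g 0 + z * dslope g 0 z := by
  have := sub_smul_dslope g 0 z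
  rw [sub_zero, smul_eq_mul] at this
  rw [this]; ring

/-- Harnack's inequality for `p` bounds a one-dimensional generator on the whole disc by its size
near the origin. -/
theorem generator_norm_le {g : ℂ → ℂ} (hg : DifferentiableOn ℂ g (ball 0 1))
    (hp : ∀ z ∈ ball (0 : ℂ) 1, 0 ≤ (-(conj (g 0) * z) - dslope g 0 z).re) {δ M : ℝ}
    (hδ : 0 < δ) (hδ1 : δ ≤ 1) (hM : ∀ z ∈ ball (0 : ℂ) δ, ‖g z‖ ≤ M) {z : ℂ}
    (hz : z ∈ ball (0 : ℂ) 1) :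
    ‖g z‖ ≤ 2 * M + 2 * M / δ * (1 + ‖z‖) / (1 - ‖z‖) := by
  have hz1 : ‖z‖ < 1 := by simpa using hz
  have hM0 : 0 ≤ M := (norm_nonneg _).trans (hM 0 (by simpa using hδ))
  have hg0 : ‖g 0‖ ≤ M := hM 0 (by simpa using hδ)
  have h1 := harnack_norm_upper (differentiableOn_generator hg) hp hz
  simp only [mul_zero, neg_zero, zero_sub, norm_neg, dslope_same] at h1
  have h2 : ‖deriv g 0‖ ≤ 2 * M / δ := by
    apply Complex.norm_deriv_le_div_of_mapsTo_ball (hg.mono (ball_subset_ball hδ1)) _ hδ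
    intro w hw
    rw [mem_closedBall, dist_eq_norm]
    linarith [norm_sub_le (g w) (g 0), hM w hw]
  have h3 : ‖dslope g 0 z‖ ≤ M + 2 * M / δ * (1 + ‖z‖) / (1 - ‖z‖) := by
    have e : dslope g 0 z = -(conj (g 0) * z) - (-(conj (g 0) * z) - dslope g 0 z) := by ring
    rw [e]
    refine (norm_sub_le _ _).trans (add_le_add ?_ (h1.trans ?_))
    · rw [norm_neg, norm_mul, RCLike.norm_conj]
      calc ‖g 0‖ * ‖z‖ ≤ M * 1 := by gcongr
        _ = M := mul_one M
    · have : 0 < 1 - ‖z‖ := by linarith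
      gcongr
  rw [eq_add_mul_dslope g z]
  calc _ ≤ ‖g 0‖ + ‖z‖ * ‖dslope g 0 z‖ := by rw [← norm_mul]; exact norm_add_le _ _
    _ ≤ M + 1 * (M + 2 * M / δ * (1 + ‖z‖) / (1 - ‖z‖)) := by gcongr
    _ = _ := by ring

/-- The sharp growth estimate for a one-dimensional generator on the positive radius. -/
theorem generator_re_le {g : ℂ → ℂ} (hg : DifferentiableOn ℂ g (ball 0 1))
    (hp : ∀ z ∈ ball (0 : ℂ) 1, 0 ≤ (-(conj (g 0) * z) - dslope g 0 z).re) {r : ℝ}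
    (hr0 : 0 ≤ r) (hr1 : r < 1) :
    (g r).re ≤ (g 0).re * (1 - r ^ 2) + r * ((deriv g 0).re * ((1 - r) / (1 + r))) := by
  have hz : (r : ℂ) ∈ ball (0 : ℂ) 1 := by simpa [abs_of_nonneg hr0] using hr1
  have h1 := harnack_re_lower (differentiableOn_generator hg) hp hz
  simp only [mul_zero, neg_zero, zero_sub, dslope_same, Complex.norm_real, Real.norm_eq_abs,
    abs_of_nonneg hr0, Complex.neg_re, Complex.sub_re, Complex.re_mul_ofReal,
    Complex.conj_re] at h1
  have h2 := congrArg Complex.re (eq_add_mul_dslope g r)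
  rw [Complex.add_re, Complex.re_ofReal_mul] at h2
  rw [h2]
  nlinarith [mul_le_mul_of_nonneg_left h1 hr0]

/-! ### The semiflow of a semi-complete holomorphic vector field -/

/-- `F t x` is a solution of `x' = h(x)` on `[0, ∞)`, with values in the open unit ball and
initial value `x`, for each `x` in the ball. No semigroup property is required. -/
structure IsForwardFlow (h : X → X) (F : ℝ → X → X) : Prop where
  zero : ∀ x ∈ ball (0 : X) 1, F 0 x = x
  mem : ∀ x ∈ ball (0 : X) 1, ∀ t, 0 ≤ t → F t x ∈ ball (0 : X) 1
  hasDerivWithinAt : ∀ x ∈ ball (0 : X) 1, ∀ t, 0 ≤ t →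
    HasDerivWithinAt (fun s => F s x) (h (F t x)) (Ici 0) t

theorem IsSemiComplete.exists_isForwardFlow {h : X → X}
    (hsc : IsSemiComplete (-h) (ball (0 : X) 1)) : ∃ F, IsForwardFlow h F := by
  choose! x hx using hsc
  refine ⟨fun t y => x y t, ⟨fun y hy => (hx y hy).1, fun y hy t ht => ((hx y hy).2 t ht).1,
    fun y hy t ht => ?_⟩⟩
  simpa using ((hx y hy).2 t ht).2

namespace IsForwardFlow

variable {h : X → X} {F : ℝ → X → X}

theorem holomorphicAlongCurves [CompleteSpace X] (hF : IsForwardFlow h F)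
    (hh : DifferentiableOn ℂ h (ball (0 : X) 1)) {t : ℝ} (ht : 0 ≤ t) :
    HolomorphicAlongCurves (F t) (ball (0 : X) 1) := by
  intro U c hU hc hm
  refine differentiableOn_solution isOpen_ball hh hU (x := fun z t => F t (c z))
    (fun z hz t ht => ⟨hF.mem _ (hm hz) t ht, hF.hasDerivWithinAt _ (hm hz) t ht⟩) ?_ ht
  exact hc.congr fun z hz => hF.zero _ (hm hz)

/-- The difference quotient `(F_t - I) / t`. -/
noncomputable def quotient (F : ℝ → X → X) (t : ℝ) (x : X) : X := (t : ℂ)⁻¹ • (F t x - x)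

theorem quotient_holomorphicAlongCurves [CompleteSpace X] (hF : IsForwardFlow h F)
    (hh : DifferentiableOn ℂ h (ball (0 : X) 1)) {t : ℝ} (ht : 0 ≤ t) :
    HolomorphicAlongCurves (quotient F t) (ball (0 : X) 1) := fun U c hU hc hm =>
  ((hF.holomorphicAlongCurves hh ht U c hU hc hm).sub hc).const_smul _

theorem tendsto_quotient (hF : IsForwardFlow h F) {x : X} (hx : x ∈ ball (0 : X) 1) :
    Tendsto (fun t => quotient F t x) (𝓝[>] 0) (𝓝 (h x)) := by
  have h1 := hF.hasDerivWithinAt x hx 0 le_rfl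
  rw [hF.zero x hx] at h1
  have h2 := (hasDerivWithinAt_iff_tendsto_slope' self_notMem_Ioi).1
    (hasDerivWithinAt_Ioi_iff_Ici.2 h1)
  refine h2.congr fun t => ?_
  rw [slope_def_module, hF.zero x hx, sub_zero, quotient, ← Complex.ofReal_inv, Complex.coe_smul]

/-- Near the origin the difference quotients are bounded, uniformly for short times. -/
theorem exists_quotient_norm_le_near_zero (hF : IsForwardFlow h F)
    (hh : DifferentiableOn ℂ h (ball (0 : X) 1)) :
    ∃ δ > 0, δ ≤ 1 ∧ ∃ M > 0, ∃ ε > 0, ∀ t ∈ Ioo 0 ε, ∀ x ∈ ball (0 : X) δ,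
      ‖quotient F t x‖ ≤ M := by
  obtain ⟨δ', hδ', M, hM0, K, hK0, hsub, hM, -⟩ :=
    hh.exists_ball_norm_le_lipschitz isOpen_ball (mem_ball_self one_pos)
  obtain ⟨δ, hδ, rfl⟩ : ∃ δ > 0, δ' = 2 * δ := ⟨δ' / 2, half_pos hδ', by ring⟩
  refine ⟨min δ 1, by positivity, min_le_right _ _, M, hM0, δ / M, by positivity, ?_⟩
  intro t ht x hx
  have hx1 : x ∈ ball (0 : X) 1 := ball_subset_ball (min_le_right _ _) hx
  have := norm_solution_sub_le ht.1.le ((lt_div_iff₀ hM0).1 ht.2) hM hδ (x := fun s => F s x)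
    (fun s hs => (hF.hasDerivWithinAt x hx1 s hs.1).mono Icc_subset_Ici_self)
    (by rw [hF.zero x hx1]; exact ball_subset_ball (min_le_left _ _) hx)
  simp only [hF.zero x hx1] at this
  rw [quotient, norm_smul, norm_inv, Complex.norm_real, Real.norm_eq_abs, abs_of_pos ht.1,
    inv_mul_le_iff₀ ht.1]
  linarith

theorem mapsTo_smul_ball {u : X} (hu : ‖u‖ ≤ 1) {r : ℝ} :
    MapsTo (fun z : ℂ => z • u) (ball 0 r) (ball (0 : X) r) := by
  intro z hz
  rw [mem_ball_zero_iff] at hz ⊢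
  rw [norm_smul]
  nlinarith [norm_nonneg z]

/-- The slice of `(F_t - I) / t` along a unit vector `u`, tested against a functional supporting
`u`, is a one-dimensional generator. -/
theorem slice_generator [CompleteSpace X] (hF : IsForwardFlow h F)
    (hh : DifferentiableOn ℂ h (ball (0 : X) 1)) {u : X} (hu : ‖u‖ = 1) {φ : StrongDual ℂ X}
    (hφ : ‖φ‖ ≤ 1) (hφu : φ u = 1) {t : ℝ} (ht : 0 < t) :
    DifferentiableOn ℂ (fun z : ℂ => φ (quotient F t (z • u))) (ball 0 1) ∧
    ∀ z ∈ ball (0 : ℂ) 1, 0 ≤ (-(conj (φ (quotient F t ((0 : ℂ) • u))) * z) -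
      dslope (fun z : ℂ => φ (quotient F t (z • u))) 0 z).re := by
  have hm := mapsTo_smul_ball hu.le (r := 1)
  constructor
  · exact φ.differentiable.comp_differentiableOn
      (hF.quotient_holomorphicAlongCurves hh ht.le _ _ isOpen_ball (by fun_prop) hm)
  · intro z hz
    refine generator_re_nonneg (f := fun z : ℂ => φ (F t (z • u)))
      (g := fun z : ℂ => φ (quotient F t (z • u)))
      (φ.differentiable.comp_differentiableOn
        (hF.holomorphicAlongCurves hh ht.le _ _ isOpen_ball (by fun_prop) hm)) ?_ ht ?_ hz
    · intro w hw
      have h1 := hF.mem _ (hm hw) t ht.le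
      rw [mem_ball_zero_iff] at h1
      calc _ ≤ ‖φ‖ * ‖F t (w • u)‖ := φ.le_opNorm _
        _ ≤ 1 * 1 := by gcongr
        _ = 1 := one_mul 1
    · intro w
      simp only [quotient, map_smul, map_sub, hφu, smul_eq_mul, mul_one]
      rw [div_eq_inv_mul]

/-- The numerical range of the difference quotients is bounded on each smaller ball, uniformly for
short times. -/
theorem exists_quotient_numRange_le [CompleteSpace X] (hF : IsForwardFlow h F)
    (hh : DifferentiableOn ℂ h (ball (0 : X) 1)) {r : ℝ} (hr : r < 1) :
    ∃ C > 0, ∃ ε > 0, ∀ t ∈ Ioo 0 ε, ∀ x ∈ ball (0 : X) r, ∀ φ : StrongDual ℂ X,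
      ‖φ‖ ≤ 1 → φ x = ‖x‖ → ‖φ (quotient F t x)‖ ≤ C := by
  obtain ⟨δ, hδ, hδ1, M, hM, ε, hε, hbd⟩ := hF.exists_quotient_norm_le_near_zero hh
  have hr' : 0 < 1 - r := by linarith
  refine ⟨2 * M + 2 * M / δ * (1 + 1) / (1 - r), by positivity, ε, hε, ?_⟩
  intro t ht x hx φ hφ hφx
  have hφle : ∀ y, ‖φ y‖ ≤ ‖y‖ := fun y =>
    (φ.le_opNorm y).trans (mul_le_of_le_one_left (norm_nonneg _) hφ)
  rcases eq_or_ne x 0 with rfl | hx0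
  · have h1 := (hφle _).trans (hbd t ht 0 (mem_ball_self hδ))
    have : 0 ≤ 2 * M / δ * (1 + 1) / (1 - r) := by positivity
    linarith
  have hxn : 0 < ‖x‖ := norm_pos_iff.2 hx0
  have hxn' : (‖x‖ : ℂ) ≠ 0 := by exact_mod_cast hxn.ne'
  set u : X := (‖x‖ : ℂ)⁻¹ • x
  have hu : ‖u‖ = 1 := by simp [u, norm_smul, hxn.ne']
  have hxu : (‖x‖ : ℂ) • u = x := by simp [u, hxn.ne']
  have hφu : φ u = 1 := by simp [u, hφx, hxn.ne']
  obtain ⟨h1, h2⟩ := hF.slice_generator hh hu hφ hφu ht.1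
  rw [mem_ball_zero_iff] at hx
  have h3 := generator_norm_le h1 h2 hδ hδ1 (M := M) (fun z hz =>
    (hφle _).trans (hbd t ht _ (mapsTo_smul_ball hu.le hz))) (z := (‖x‖ : ℂ))
    (by simpa using hx.trans hr)
  simp only [hxu, Complex.norm_real, norm_norm] at h3
  refine h3.trans ?_
  gcongr
  linarith

/-- Passing to the limit `t → 0` in the one-dimensional slices of `(F_t - I) / t`. -/
theorem slice_field [CompleteSpace X] (hF : IsForwardFlow h F)
    (hh : DifferentiableOn ℂ h (ball (0 : X) 1)) {u : X} (hu : ‖u‖ = 1) {φ : StrongDual ℂ X}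
    (hφ : ‖φ‖ ≤ 1) (hφu : φ u = 1) :
    DifferentiableOn ℂ (fun z : ℂ => φ (h (z • u))) (ball 0 1) ∧
    ∀ z ∈ ball (0 : ℂ) 1, 0 ≤ (-(conj (φ (h ((0 : ℂ) • u))) * z) -
      dslope (fun z : ℂ => φ (h (z • u))) 0 z).re := by
  have hm := mapsTo_smul_ball hu.le (r := 1)
  have hd : DifferentiableOn ℂ (fun z : ℂ => φ (h (z • u))) (ball 0 1) :=
    φ.differentiable.comp_differentiableOn (hh.comp (by fun_prop) hm)
  have hlim : ∀ z ∈ ball (0 : ℂ) 1, Tendsto (fun t => φ (quotient F t (z • u))) (𝓝[>] 0)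
      (𝓝 (φ (h (z • u)))) := fun z hz =>
    (φ.continuous.tendsto _).comp (hF.tendsto_quotient (hm hz))
  have hne : ∀ z ∈ ball (0 : ℂ) 1, z ≠ 0 → 0 ≤ (-(conj (φ (h ((0 : ℂ) • u))) * z) -
      dslope (fun z : ℂ => φ (h (z • u))) 0 z).re := by
    intro z hz hz0
    have h0 := hlim 0 (by simp)
    have hc := (Complex.continuous_conj.tendsto _).comp h0
    have h1 := (hc.mul_const z).neg.sub (((hlim z hz).sub h0).div_const (z - 0))
    have h2 := (Complex.continuous_re.tendsto _).comp h1
    rw [dslope_of_ne _ hz0, slope_def_field]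
    refine ge_of_tendsto h2 ?_
    filter_upwards [self_mem_nhdsWithin] with t ht
    have := (hF.slice_generator hh hu hφ hφu ht).2 z hz
    rw [dslope_of_ne _ hz0, slope_def_field] at this
    exact this
  refine ⟨hd, fun z hz => ?_⟩
  rcases eq_or_ne z 0 with rfl | hz0
  · have hcont := ((differentiableOn_generator hd).differentiableAt
      (ball_mem_nhds 0 one_pos)).continuousAt
    have h2 := ((Complex.continuous_re.tendsto _).comp hcont).mono_left
      (nhdsWithin_le_nhds (s := {0}ᶜ))
    refine ge_of_tendsto h2 ?_
    filter_upwards [self_mem_nhdsWithin, nhdsWithin_le_nhds (ball_mem_nhds (0 : ℂ) one_pos)]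
      with w hw hw1 using hne w hw1 hw
  · exact hne z hz hz0

theorem deriv_slice (hh : DifferentiableOn ℂ h (ball (0 : X) 1)) (u : X) (φ : StrongDual ℂ X) :
    deriv (fun z : ℂ => φ (h (z • u))) 0 = φ (fderiv ℂ h 0 u) := by
  have h1 : HasFDerivAt h (fderiv ℂ h 0) ((0 : ℂ) • u) := by
    rw [zero_smul]
    exact (hh.differentiableAt (ball_mem_nhds _ one_pos)).hasFDerivAt
  have h2 : HasDerivAt (fun z : ℂ => z • u) u 0 := by
    simpa using (hasDerivAt_id (0 : ℂ)).smul_const u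
  exact (φ.hasFDerivAt.comp_hasDerivAt _ (h1.comp_hasDerivAt _ h2)).deriv

theorem re_fderiv_nonpos [CompleteSpace X] (hF : IsForwardFlow h F)
    (hh : DifferentiableOn ℂ h (ball (0 : X) 1)) {u : X} (hu : ‖u‖ = 1) {φ : StrongDual ℂ X}
    (hφ : ‖φ‖ ≤ 1) (hφu : φ u = 1) : (φ (fderiv ℂ h 0 u)).re ≤ 0 := by
  have := (hF.slice_field hh hu hφ hφu).2 0 (by simp)
  rw [dslope_same, deriv_slice hh] at this
  simpa using this

end IsForwardFlow

theorem mem_dualitySet_of_norm_eq_one {u : X} (hu : ‖u‖ = 1) {φ : StrongDual ℂ X}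
    (hφ : ‖φ‖ ≤ 1) (hφu : φ u = 1) : φ ∈ dualitySet u := by
  have : ‖φ‖ = 1 := by
    apply le_antisymm hφ
    have := φ.le_opNorm u
    rwa [hφu, hu, norm_one, mul_one] at this
  simp [dualitySet, hu, hφu, this]

theorem re_fderiv_le_derivNumSup {h : X → X} {u : X} (hu : ‖u‖ = 1) {φ : StrongDual ℂ X}
    (hφ : ‖φ‖ ≤ 1) (hφu : φ u = 1) : (φ (fderiv ℂ h 0 u)).re ≤ derivNumSup h := by
  have : Nontrivial X := ⟨u, 0, by rintro rfl; simp at hu⟩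
  exact (isLUB_derivNumSup h).1 ⟨_, ⟨u, hu, φ, mem_dualitySet_of_norm_eq_one hu hφ hφu, rfl⟩, rfl⟩

theorem IsForwardFlow.derivNumSup_nonpos [CompleteSpace X] {h : X → X} {F : ℝ → X → X}
    (hF : IsForwardFlow h F) (hh : DifferentiableOn ℂ h (ball (0 : X) 1)) :
    derivNumSup h ≤ 0 := by
  apply Real.sSup_nonpos
  rintro _ ⟨_, ⟨u, hu, φ, ⟨h1, h2⟩, rfl⟩, rfl⟩
  rw [hu] at h1 h2
  refine hF.re_fderiv_nonpos hh hu ?_ (by simpa using h1)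
  nlinarith [norm_nonneg φ]

/-- The growth estimate: `Re ⟨h(x), x*⟩ / ‖x‖` is at most
`(1 - r) / (1 + r) * (‖h(0)‖ (1 + r)² + L r)` at `r = ‖x‖`. -/
theorem IsForwardFlow.re_le [CompleteSpace X] {h : X → X} {F : ℝ → X → X}
    (hF : IsForwardFlow h F) (hh : DifferentiableOn ℂ h (ball (0 : X) 1)) {x : X}
    (hx : ‖x‖ < 1) {φ : StrongDual ℂ X} (hφ : ‖φ‖ ≤ 1) (hφx : φ x = ‖x‖) :
    (φ (h x)).re ≤
      (1 - ‖x‖) / (1 + ‖x‖) * (‖h 0‖ * (1 + ‖x‖) ^ 2 + derivNumSup h * ‖x‖) := by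
  have hφle : ∀ y, ‖φ y‖ ≤ ‖y‖ := fun y =>
    (φ.le_opNorm y).trans (mul_le_of_le_one_left (norm_nonneg _) hφ)
  have h0 : (φ (h 0)).re ≤ ‖h 0‖ := (Complex.re_le_norm _).trans (hφle _)
  rcases eq_or_ne x 0 with rfl | hx0
  · simpa using h0
  have hxn : 0 < ‖x‖ := norm_pos_iff.2 hx0
  set u : X := (‖x‖ : ℂ)⁻¹ • x
  have hu : ‖u‖ = 1 := by simp [u, norm_smul, hxn.ne']
  have hxu : (‖x‖ : ℂ) • u = x := by simp [u, hxn.ne']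
  have hφu : φ u = 1 := by simp [u, hφx, hxn.ne']
  obtain ⟨h1, h2⟩ := hF.slice_field hh hu hφ hφu
  have h3 := generator_re_le h1 h2 hxn.le hx
  simp only [hxu, zero_smul, IsForwardFlow.deriv_slice hh] at h3
  have h4 := re_fderiv_le_derivNumSup (h := h) hu hφ hφu
  set r := ‖x‖
  have h5 : (1 - r) / (1 + r) * (‖h 0‖ * (1 + r) ^ 2 + derivNumSup h * r)
      = ‖h 0‖ * (1 - r ^ 2) + r * (derivNumSup h * ((1 - r) / (1 + r))) := by
    field_simp; ring
  rw [h5]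
  have h6 : 0 ≤ (1 - r) / (1 + r) := div_nonneg (by linarith) (by linarith)
  have h7 : 0 ≤ 1 - r ^ 2 := by nlinarith
  refine h3.trans (add_le_add (mul_le_mul_of_nonneg_right h0 h7) ?_)
  gcongr

/-! ### From bounds on the numerical range to bounds on the norm -/

/-- One Euler step for a Lipschitz field increases the norm at most by the bound on the numerical
range, up to second order in the step. -/
theorem norm_add_smul_le {H : X → X} {D : Set X} {K N M : ℝ} (hK0 : 0 ≤ K)
    (hN : ∀ x ∈ D, ‖H x‖ ≤ N) (hK : ∀ x ∈ D, ∀ x' ∈ D, ‖H x' - H x‖ ≤ K * ‖x' - x‖) {x : X}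
    {σ : ℂ} (hx : x ∈ D) (hy : x + σ • H x ∈ D)
    (hM : ∀ φ : StrongDual ℂ X, ‖φ‖ ≤ 1 → φ (x + σ • H x) = ‖x + σ • H x‖ →
      (σ * φ (H (x + σ • H x))).re ≤ ‖σ‖ * M) :
    ‖x + σ • H x‖ ≤ ‖x‖ + ‖σ‖ * (M + K * (‖σ‖ * N)) := by
  set y := x + σ • H x with hydef
  obtain ⟨φ, hφ, hφy⟩ := exists_dual_vector'' ℂ y
  have hφle : ∀ y, ‖φ y‖ ≤ ‖y‖ := fun y =>
    (φ.le_opNorm y).trans (mul_le_of_le_one_left (norm_nonneg _) hφ)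
  have h1 : (‖y‖ : ℝ) = (φ x).re + (σ * φ (H y)).re + (σ * φ (H x - H y)).re := by
    have := congrArg Complex.re (show φ y = ((‖y‖ : ℝ) : ℂ) from hφy)
    rw [Complex.ofReal_re] at this
    rw [← this, ← Complex.add_re, ← Complex.add_re, hydef, map_add, map_smul, smul_eq_mul,
      ← hydef, map_sub]
    congr 1
    ring
  have h2 : (σ * φ (H x - H y)).re ≤ ‖σ‖ * (K * (‖σ‖ * N)) := by
    calc _ ≤ ‖σ * φ (H x - H y)‖ := Complex.re_le_norm _
      _ = ‖σ‖ * ‖φ (H x - H y)‖ := norm_mul _ _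
      _ ≤ ‖σ‖ * (K * ‖x - y‖) := by
        gcongr
        exact (hφle _).trans (hK y hy x hx)
      _ ≤ ‖σ‖ * (K * (‖σ‖ * N)) := by
        have : ‖x - y‖ = ‖σ‖ * ‖H x‖ := by
          rw [hydef, sub_add_cancel_left, norm_neg, norm_smul]
        rw [this]
        gcongr
        exact hN x hx
  have h3 := (Complex.re_le_norm _).trans (hφle x)
  have h4 := hM φ hφ hφy
  rw [h1]
  linarith

/-- A map whose numerical range on the ball of radius `R` is bounded by `M` is bounded on smaller
balls by a constant that does not depend on the a priori bound `N`. The Euler polygons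
`(I + (ζ / n) H)ⁿ x` are holomorphic in the complex time `ζ` and stay in the ball for `‖ζ‖ < τ`,
and their derivative at `ζ = 0` is `H x`, so that Cauchy's estimate applies. -/
theorem norm_le_of_numRange_le {H : X → X} {R r τ M N : ℝ}
    (hH : HolomorphicAlongCurves H (ball (0 : X) R)) (hN : ∀ x ∈ ball (0 : X) R, ‖H x‖ ≤ N)
    (hM : ∀ x ∈ ball (0 : X) R, ∀ φ : StrongDual ℂ X, ‖φ‖ ≤ 1 → φ x = ‖x‖ → ‖φ (H x)‖ ≤ M)
    (hM0 : 0 ≤ M) (hτ : 0 < τ) (hr : r + τ * M < R) {x : X} (hx : x ∈ ball (0 : X) r) :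
    ‖H x‖ ≤ 2 * R / τ := by
  obtain ⟨R', hR'1, hR'2⟩ := exists_between hr
  have hxr : ‖x‖ < r := by simpa using hx
  have hτM : 0 ≤ τ * M := by positivity
  have hxR : x ∈ ball (0 : X) R := ball_subset_ball (by linarith) hx
  have hN0 : 0 ≤ N := (norm_nonneg _).trans (hN x hxR)
  set K := 2 * N / (R - R') with hKdef
  have hK0 : 0 ≤ K := div_nonneg (by linarith) (by linarith)
  have hsub : ball (0 : X) R' ⊆ ball 0 R := ball_subset_ball hR'2.le
  have hK : ∀ x ∈ ball (0 : X) R', ∀ x' ∈ ball (0 : X) R', ‖H x' - H x‖ ≤ K * ‖x' - x‖ :=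
    fun x hx x' hx' => hH.norm_sub_le hR'2 hN hx hx'
  -- so many steps that the second order errors do not lead out of the ball of radius `R'`
  obtain ⟨n, hn0, hn⟩ : ∃ n : ℕ, 0 < n ∧
      r + τ * M + (K * N * τ ^ 2 + N * τ) / n < R' := by
    have hlim : Tendsto (fun n : ℕ => r + τ * M + (K * N * τ ^ 2 + N * τ) / n) atTop
        (𝓝 (r + τ * M + 0)) := (tendsto_const_div_atTop_nhds_zero_nat _).const_add _
    rw [add_zero] at hlim
    exact ((eventually_gt_atTop 0).and (hlim.eventually_lt_const hR'1)).exists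
  have hnpos : (0 : ℝ) < n := by exact_mod_cast hn0
  set E : ℕ → ℂ → X := fun k ζ => (fun w => w + (ζ / n) • H w)^[k] x with hE
  have hEsucc : ∀ k ζ, E (k + 1) ζ = E k ζ + (ζ / n) • H (E k ζ) := by
    intro k z
    simp only [hE, Function.iterate_succ_apply']
  have hEbd : ∀ k ≤ n, ∀ ζ ∈ ball (0 : ℂ) τ,
      ‖E k ζ‖ ≤ ‖x‖ + k * (τ / n * (M + K * (τ / n * N))) ∧ E k ζ ∈ ball (0 : X) R' := by
    have hend : ∀ k ≤ n, ‖x‖ + k * (τ / n * (M + K * (τ / n * N))) + τ / n * N < R' := by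
      intro k hk
      have hk' : (k : ℝ) ≤ n := by exact_mod_cast hk
      calc _ ≤ ‖x‖ + n * (τ / n * (M + K * (τ / n * N))) + τ / n * N := by gcongr
        _ = ‖x‖ + τ * M + (K * N * τ ^ 2 + N * τ) / n := by field_simp; ring
        _ < R' := by linarith
    have hpos : 0 ≤ τ / n * N := by positivity
    intro k
    induction k with
    | zero =>
      intro h0 ζ _
      have := hend 0 h0
      refine ⟨by simp [hE], ?_⟩
      simp only [hE, Function.iterate_zero, id, mem_ball_zero_iff]
      simp only [Nat.cast_zero, zero_mul, add_zero] at this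
      linarith
    | succ k ih =>
      intro hk ζ hζ
      obtain ⟨h1, h2⟩ := ih (by omega) ζ hζ
      have hσ : ‖ζ / (n : ℂ)‖ ≤ τ / n := by
        rw [norm_div, Complex.norm_natCast]
        gcongr
        exact (mem_ball_zero_iff.1 hζ).le
      have hy : E (k + 1) ζ ∈ ball (0 : X) R' := by
        rw [mem_ball_zero_iff, hEsucc]
        calc _ ≤ ‖E k ζ‖ + ‖ζ / (n : ℂ)‖ * ‖H (E k ζ)‖ := by
              rw [← norm_smul]; exact norm_add_le _ _
          _ ≤ ‖x‖ + k * (τ / n * (M + K * (τ / n * N))) + τ / n * N := by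
              gcongr; exact hN _ (hsub h2)
          _ < R' := hend k (by omega)
      refine ⟨?_, hy⟩
      rw [hEsucc] at hy ⊢
      have h3 := norm_add_smul_le (M := M) hK0 (fun x hx => hN x (hsub hx)) hK h2 hy
        (fun φ hφ hφy => by
          refine (Complex.re_le_norm _).trans ?_
          rw [norm_mul]
          gcongr
          exact hM _ (hsub hy) φ hφ hφy)
      calc _ ≤ _ := h3
        _ ≤ (‖x‖ + k * (τ / n * (M + K * (τ / n * N)))) + τ / n * (M + K * (τ / n * N)) := by
          gcongr
        _ = _ := by push_cast; ring
  have hEd : ∀ k ≤ n, DifferentiableOn ℂ (E k) (ball 0 τ) := by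
    intro k
    induction k with
    | zero => intro _; exact differentiableOn_const _
    | succ k ih =>
      intro hk
      have h1 := ih (by omega)
      have h2 : DifferentiableOn ℂ (fun z => H (E k z)) (ball 0 τ) :=
        hH _ _ isOpen_ball h1 fun z hz => hsub (hEbd k (by omega) z hz).2
      have h3 : DifferentiableOn ℂ (fun z : ℂ => z / (n : ℂ)) (ball 0 τ) := by fun_prop
      exact (h1.add (h3.smul h2)).congr fun z _ => hEsucc k z
  have hE0 : ∀ k, E k 0 = x := by
    intro k
    induction k with
    | zero => rfl
    | succ k ih => rw [hEsucc, ih]; simp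
  have hEderiv : ∀ k ≤ n, HasDerivAt (E k) (((k : ℂ) / n) • H x) 0 := by
    intro k
    induction k with
    | zero =>
      intro _
      have : E 0 = fun _ => x := rfl
      rw [this]
      simpa using hasDerivAt_const (0 : ℂ) x
    | succ k ih =>
      intro hk
      have h1 := ih (by omega)
      have h2 : DifferentiableOn ℂ (fun z => H (E k z)) (ball 0 τ) :=
        hH _ _ isOpen_ball (hEd k (by omega)) fun z hz => hsub (hEbd k (by omega) z hz).2
      have h3 := ((hasDerivAt_id (0 : ℂ)).div_const (n : ℂ)).smul
        (h2.differentiableAt (ball_mem_nhds _ hτ)).hasDerivAt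
      have h4 := h1.add h3
      simp only [id, zero_div, zero_smul, zero_add, hE0, ← add_smul] at h4
      convert h4.congr_of_eventuallyEq (Eventually.of_forall fun z => hEsucc k z) using 2
      push_cast; ring
  have hfin := Complex.norm_deriv_le_div_of_mapsTo_ball (f := E n) (R₂ := 2 * R) (hEd n le_rfl)
    (by
      intro ζ hζ
      have h1 := mem_ball_zero_iff.1 (hsub (hEbd n le_rfl ζ hζ).2)
      rw [mem_closedBall, dist_eq_norm, hE0]
      linarith [norm_sub_le (E n ζ) x]) hτ
  rw [(hEderiv n le_rfl).deriv, div_self (by exact_mod_cast hn0.ne'), one_smul] at hfin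
  exact hfin

/-- The generator of a semiflow on the unit ball is bounded on every strictly smaller ball. -/
theorem IsForwardFlow.exists_norm_le [CompleteSpace X] {h : X → X} {F : ℝ → X → X}
    (hF : IsForwardFlow h F) (hh : DifferentiableOn ℂ h (ball (0 : X) 1)) {r : ℝ} (hr0 : 0 < r)
    (hr : r < 1) : ∃ C > 0, ∀ x ∈ ball (0 : X) r, ‖h x‖ ≤ C := by
  obtain ⟨R, hrR, hR1⟩ := exists_between hr
  obtain ⟨M, hM, ε, hε, hnum⟩ := hF.exists_quotient_numRange_le hh hR1
  have hsub : ball (0 : X) R ⊆ ball 0 1 := ball_subset_ball hR1.le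
  have hτ : 0 < (R - r) / (2 * M) := div_pos (by linarith) (by linarith)
  refine ⟨2 * R / ((R - r) / (2 * M)), div_pos (by linarith) hτ, fun x hx => ?_⟩
  refine le_of_tendsto
    (hF.tendsto_quotient (ball_subset_ball (by linarith) hx : x ∈ ball (0 : X) 1)).norm ?_
  filter_upwards [Ioo_mem_nhdsGT hε] with t ht
  refine norm_le_of_numRange_le (N := t⁻¹ * 2)
    ((hF.quotient_holomorphicAlongCurves hh ht.1.le).mono hsub) ?_ (hnum t ht) hM.le hτ ?_ hx
  · intro y hy
    have h1 := mem_ball_zero_iff.1 (hsub hy)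
    have h2 := mem_ball_zero_iff.1 (hF.mem y (hsub hy) t ht.1.le)
    rw [quotient, norm_smul, norm_inv, Complex.norm_real, Real.norm_eq_abs, abs_of_pos ht.1]
    have := inv_nonneg.2 ht.1.le
    gcongr
    linarith [norm_sub_le (F t y) y]
  · have : (R - r) / (2 * M) * M = (R - r) / 2 := by field_simp
    rw [this]
    linarith

/-! ### Invariance of balls under the flows -/

/-- A dissipative bounded operator generates a semigroup of contractions, the exponential, which
preserves every ball around the origin. -/
theorem ContinuousLinearMap.isSemiComplete_of_re_nonpos [CompleteSpace X] {A : X →L[ℂ] X}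
    (hA : ∀ u : X, ‖u‖ = 1 → ∀ φ : StrongDual ℂ X, ‖φ‖ ≤ 1 → φ u = 1 → (φ (A u)).re ≤ 0)
    (R : ℝ) : IsSemiComplete (-(A : X → X)) (ball (0 : X) R) := by
  have hA' : ∀ x : X, ∀ φ : StrongDual ℂ X, ‖φ‖ ≤ 1 → φ x = ‖x‖ → (φ (A x)).re ≤ 0 := by
    intro x φ hφ hφx
    rcases eq_or_ne x 0 with rfl | hx0
    · simp
    have hxn : 0 < ‖x‖ := norm_pos_iff.2 hx0
    have h1 := hA ((‖x‖ : ℂ)⁻¹ • x) (by simp [norm_smul, hxn.ne']) φ hφ (by simp [hφx, hxn.ne'])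
    rw [map_smul, map_smul, ← Complex.ofReal_inv, smul_eq_mul, Complex.re_ofReal_mul] at h1
    exact nonpos_of_mul_nonpos_right h1 (inv_pos.2 hxn)
  intro x₀ hx₀
  have hd : ∀ t : ℝ, HasDerivAt (fun s : ℝ => NormedSpace.exp (s • A) x₀)
      (A (NormedSpace.exp (t • A) x₀)) t := fun t =>
    ((ContinuousLinearMap.apply ℂ X x₀).restrictScalars ℝ).hasFDerivAt.comp_hasDerivAt t
      (hasDerivAt_exp_smul_const' (𝕂 := ℝ) A t)
  have h0 : NormedSpace.exp ((0 : ℝ) • A) x₀ = x₀ := by simp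
  refine ⟨fun s => NormedSpace.exp (s • A) x₀, h0, fun t ht => ⟨?_, ?_⟩⟩
  · -- for every `ε > 0` the norm stays below a barrier that rises at speed `ε`
    rw [mem_ball_zero_iff] at hx₀ ⊢
    obtain ⟨c, hc1, hc2⟩ := exists_between hx₀
    have hε : 0 < (R - c) / (t + 1) := div_pos (by linarith) (by linarith)
    have := norm_lt_of_barrier (x := fun s => NormedSpace.exp (s • A) x₀)
      (v := fun s => A (NormedSpace.exp (s • A) x₀))
      (b := fun s => c + s * ((R - c) / (t + 1))) (b' := fun _ => (R - c) / (t + 1)) (T := t)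
      (fun s _ => (hd s).hasDerivWithinAt)
      (fun s _ => by
        simpa using ((hasDerivWithinAt_id s _).mul_const ((R - c) / (t + 1))).const_add c)
      (by simpa using hc1) (fun s _ _ => by
        obtain ⟨φ, hφ, hφx⟩ := exists_dual_vector'' ℂ (NormedSpace.exp (s • A) x₀)
        exact ⟨φ, hφ, hφx, (hA' _ φ hφ hφx).trans_lt hε⟩) t ⟨ht, le_rfl⟩
    refine this.trans_le ?_
    have h1 : t * ((R - c) / (t + 1)) ≤ R - c := by
      rw [mul_div_assoc', div_le_iff₀ (by linarith)]
      nlinarith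
    linarith
  · simpa using (hd t).hasDerivWithinAt

/-- If the radial growth of the field is dominated by `C (r - ‖x‖)` inside the ball of radius `r`,
then the ball is invariant: the distance to the sphere decays at most exponentially. -/
theorem IsForwardFlow.isSemiComplete_ball {h : X → X} {F : ℝ → X → X} (hF : IsForwardFlow h F)
    {r C : ℝ} (hr : r ≤ 1)
    (hC : ∀ x : X, ‖x‖ < r → ∀ φ : StrongDual ℂ X, ‖φ‖ ≤ 1 → φ x = ‖x‖ →
      (φ (h x)).re ≤ C * (r - ‖x‖)) :
    IsSemiComplete (-h) (ball (0 : X) r) := by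
  intro x₀ hx₀
  have hx1 : x₀ ∈ ball (0 : X) 1 := ball_subset_ball hr hx₀
  refine ⟨fun t => F t x₀, hF.zero x₀ hx1, fun t ht => ⟨?_, ?_⟩⟩
  · rw [mem_ball_zero_iff] at hx₀ ⊢
    obtain ⟨c, hc1, hc2⟩ := exists_between hx₀
    have hpos : ∀ s, 0 < (r - c) * Real.exp (-(C + 1) * s) := fun s =>
      mul_pos (by linarith) (Real.exp_pos _)
    have := norm_lt_of_barrier (x := fun s => F s x₀) (v := fun s => h (F s x₀))
      (b := fun s => r - (r - c) * Real.exp (-(C + 1) * s))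
      (b' := fun s => (C + 1) * ((r - c) * Real.exp (-(C + 1) * s))) (T := t)
      (fun s hs => (hF.hasDerivWithinAt x₀ hx1 s hs.1).mono Icc_subset_Ici_self)
      (fun s _ => by
        have h1 : HasDerivAt (fun s : ℝ => -(C + 1) * s) (-(C + 1)) s := by
          simpa using (hasDerivAt_id s).const_mul (-(C + 1))
        have h2 := (h1.exp.const_mul (r - c)).const_sub r
        have h3 : (C + 1) * ((r - c) * Real.exp (-(C + 1) * s))
          = -((r - c) * (Real.exp (-(C + 1) * s) * -(C + 1))) := by ring
        rw [h3]
        exact h2.hasDerivWithinAt)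
      (by simpa [hF.zero x₀ hx1] using hc1) (fun s _ hs => by
        obtain ⟨φ, hφ, hφx⟩ := exists_dual_vector'' ℂ (F s x₀)
        refine ⟨φ, hφ, hφx, ?_⟩
        have h1 := hC (F s x₀) (by rw [hs]; linarith [hpos s]) φ hφ hφx
        rw [hs] at h1
        have := hpos s
        nlinarith) t ⟨ht, le_rfl⟩
    linarith [hpos t]
  · simpa using hF.hasDerivWithinAt x₀ hx1 t ht

/-! ### The Earle–Hamilton fixed point theorem on balls -/

/-- If `T` maps the ball of radius `r` into the ball of radius `r - ε`, then the derivatives of its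
iterates decay geometrically. For `x_k = T^k x` the maps `S_k z = T z + η (T z - T x_k)` with
`η = ε / (2r)` still preserve the ball, agree with `T` at `x_k`, and have derivative
`(1 + η) T'(x_k)` there; Cauchy's estimate for `S_{n-1} ∘ ⋯ ∘ S_0` bounds
`(1 + η)^n ‖(T^n)'(x)‖`. -/
theorem norm_fderiv_iterate_le {T : X → X} {r ε : ℝ} (hε : 0 < ε) (hr : 0 < r)
    (hT : DifferentiableOn ℂ T (ball 0 r)) (hm : ∀ x ∈ ball (0 : X) r, ‖T x‖ ≤ r - ε) {x : X}
    (hx : ‖x‖ ≤ r - ε) (n : ℕ) :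
    DifferentiableAt ℂ T^[n] x ∧ (1 + ε / (2 * r)) ^ n * ‖fderiv ℂ T^[n] x‖ ≤ 2 * r / ε := by
  set η := ε / (2 * r) with hη
  have hη0 : 0 < η := by positivity
  have hxr : x ∈ ball (0 : X) r := by rw [mem_ball_zero_iff]; linarith
  have hm' : MapsTo T (ball 0 r) (ball 0 r) := fun z hz => by
    rw [mem_ball_zero_iff]; linarith [hm z hz]
  have hxk : ∀ k, T^[k] x ∈ ball (0 : X) r := fun k => hm'.iterate k hxr
  have hTd : ∀ k, DifferentiableAt ℂ T^[k] x := by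
    intro k
    induction k with
    | zero => exact differentiableAt_id
    | succ k ih =>
      rw [Function.iterate_succ']
      exact (hT.differentiableAt (isOpen_ball.mem_nhds (hxk k))).comp x ih
  refine ⟨hTd n, ?_⟩
  obtain ⟨G, hGd, hGm, hGx, hG'⟩ : ∃ G : X → X, DifferentiableOn ℂ G (ball 0 r) ∧
      MapsTo G (ball 0 r) (ball 0 r) ∧ G x = T^[n] x ∧
      HasFDerivAt G (((1 + η : ℝ) : ℂ) ^ n • fderiv ℂ T^[n] x) x := by
    clear hx
    induction n with
    | zero =>
      refine ⟨id, differentiableOn_id, mapsTo_id _, rfl, ?_⟩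
      simpa using hasFDerivAt_id x
    | succ k ih =>
      obtain ⟨G, hGd, hGm, hGx, hG'⟩ := ih
      have hTG : DifferentiableOn ℂ (fun z => T (G z)) (ball 0 r) := hT.comp hGd hGm
      refine ⟨fun z => T (G z) + (η : ℂ) • (T (G z) - T (T^[k] x)),
        hTG.add ((hTG.sub_const _).const_smul _), ?_, ?_, ?_⟩
      · intro z hz
        have h1 := hm _ (hGm hz)
        have h2 := hm _ (hxk k)
        rw [mem_ball_zero_iff]
        calc _ ≤ ‖T (G z)‖ + η * (‖T (G z)‖ + ‖T (T^[k] x)‖) := by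
              refine (norm_add_le _ _).trans ?_
              rw [norm_smul, Complex.norm_real, Real.norm_eq_abs, abs_of_pos hη0]
              gcongr
              exact norm_sub_le _ _
          _ ≤ (r - ε) + η * ((r - ε) + (r - ε)) := by gcongr
          _ = r - ε ^ 2 / r := by rw [hη]; field_simp; ring
          _ < r := by have : 0 < ε ^ 2 / r := by positivity
                      linarith
      · simp only [hGx, Function.iterate_succ_apply', sub_self, smul_zero, add_zero]
      · have hTx : HasFDerivAt T (fderiv ℂ T (T^[k] x)) (G x) := by
          rw [hGx]
          exact (hT.differentiableAt (isOpen_ball.mem_nhds (hxk k))).hasFDerivAt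
        have h1 := hTx.comp x hG'
        have h2 := h1.add ((h1.sub_const (T (T^[k] x))).const_smul (η : ℂ))
        have h3 : fderiv ℂ T^[k + 1] x = (fderiv ℂ T (T^[k] x)).comp (fderiv ℂ T^[k] x) := by
          rw [Function.iterate_succ']
          exact fderiv_comp x (hT.differentiableAt (isOpen_ball.mem_nhds (hxk k))) (hTd k)
        refine h2.congr_fderiv ?_
        rw [h3, ContinuousLinearMap.comp_smul, smul_smul, ← add_smul]
        congr 1
        push_cast; ring
  have hb : ball x ε ⊆ ball 0 r := by
    intro z hz
    rw [mem_ball_iff_norm] at hz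
    rw [mem_ball_zero_iff]
    calc ‖z‖ = ‖(z - x) + x‖ := by rw [sub_add_cancel]
      _ ≤ _ := norm_add_le _ _
      _ < r := by linarith
  have := Complex.norm_fderiv_le_div_of_mapsTo_ball (f := G) (c := x) (R₁ := ε) (R₂ := 2 * r)
    (hGd.mono hb) (by
      intro z hz
      rw [mem_closedBall, dist_eq_norm]
      linarith [norm_sub_le (G z) (G x), mem_ball_zero_iff.1 (hGm (hb hz)),
        mem_ball_zero_iff.1 (hGm hxr)]) hε
  rw [hG'.fderiv, norm_smul, norm_pow, Complex.norm_real, Real.norm_eq_abs,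
    abs_of_pos (by linarith)] at this
  exact this

/-- The **Earle–Hamilton theorem** on a ball, together with the invertibility of `I - T'(p)` at the
fixed point `p`. -/
theorem exists_fixedPoint_of_mapsTo_smaller_ball [CompleteSpace X] {T : X → X} {r ε : ℝ}
    (hε : 0 < ε) (hr : 0 < r) (hT : DifferentiableOn ℂ T (ball 0 r))
    (hm : ∀ x ∈ ball (0 : X) r, ‖T x‖ ≤ r - ε) :
    ∃ p ∈ ball (0 : X) r, T p = p ∧ (∀ y ∈ ball (0 : X) r, T y = y → y = p) ∧
      IsUnit (1 - fderiv ℂ T p) ∧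
      TendstoUniformlyOn (fun n : ℕ => T^[n]) (fun _ => p) atTop (ball 0 r) := by
  have hεr : ε ≤ r := by
    have := hm 0 (mem_ball_self hr)
    linarith [norm_nonneg (T 0)]
  set q := (1 + ε / (2 * r))⁻¹ with hq
  have hpos : 0 < ε / (2 * r) := by positivity
  have hq0 : 0 < q := by positivity
  have hq1 : q < 1 := inv_lt_one_of_one_lt₀ (by linarith)
  set C := 2 * r / ε with hC
  have hC0 : 0 < C := by positivity
  have hbound : ∀ n, ∀ x ∈ closedBall (0 : X) (r - ε),
      DifferentiableAt ℂ T^[n] x ∧ ‖fderiv ℂ T^[n] x‖ ≤ C * q ^ n := by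
    intro n x hx
    obtain ⟨h1, h2⟩ := norm_fderiv_iterate_le hε hr hT hm (mem_closedBall_zero_iff.1 hx) n
    refine ⟨h1, ?_⟩
    rw [hq, inv_pow, ← div_eq_mul_inv, le_div_iff₀ (by positivity), mul_comm]
    exact h2
  have hlip : ∀ n, ∀ x ∈ closedBall (0 : X) (r - ε), ∀ y ∈ closedBall (0 : X) (r - ε),
      ‖T^[n] y - T^[n] x‖ ≤ C * q ^ n * ‖y - x‖ := fun n x hx y hy =>
    (convex_closedBall 0 (r - ε)).norm_image_sub_le_of_norm_fderiv_le
      (fun z hz => (hbound n z hz).1) (fun z hz => (hbound n z hz).2) hx hy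
  have hsub : closedBall (0 : X) (r - ε) ⊆ ball 0 r := closedBall_subset_ball (by linarith)
  have hmc : ∀ x ∈ ball (0 : X) r, T x ∈ closedBall (0 : X) (r - ε) := fun x hx =>
    mem_closedBall_zero_iff.2 (hm x hx)
  have h00 : (0 : X) ∈ closedBall (0 : X) (r - ε) := mem_closedBall_self (by linarith)
  have hiter : ∀ n, T^[n] 0 ∈ closedBall (0 : X) (r - ε) := by
    intro n
    induction n with
    | zero => exact h00
    | succ n ih => rw [Function.iterate_succ_apply']; exact hmc _ (hsub ih)
  have hcau : CauchySeq fun n => T^[n] (0 : X) := by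
    apply cauchySeq_of_le_geometric q (C * ‖T 0‖) hq1
    intro n
    rw [dist_comm, dist_eq_norm, Function.iterate_succ_apply]
    have := hlip n 0 h00 (T 0) (hmc 0 (mem_ball_self hr))
    rw [sub_zero] at this
    linarith
  obtain ⟨p, hp⟩ := cauchySeq_tendsto_of_complete hcau
  have hpc : p ∈ closedBall (0 : X) (r - ε) :=
    isClosed_closedBall.mem_of_tendsto hp (Eventually.of_forall hiter)
  have hTp : T p = p := by
    have h1 : Tendsto (fun n => T (T^[n] 0)) atTop (𝓝 (T p)) :=
      (hT.differentiableAt (isOpen_ball.mem_nhds (hsub hpc))).continuousAt.tendsto.comp hp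
    have h2 : Tendsto (fun n => T (T^[n] 0)) atTop (𝓝 p) := by
      have := hp.comp (tendsto_add_atTop_nat 1)
      simpa only [Function.comp_def, Function.iterate_succ_apply'] using this
    exact tendsto_nhds_unique h1 h2
  have hTnp : ∀ n, T^[n] p = p := fun n => Function.iterate_fixed hTp n
  have hgeom : Tendsto (fun n : ℕ => C * q ^ n * (2 * r)) atTop (𝓝 0) := by
    simpa using ((tendsto_pow_atTop_nhds_zero_of_lt_one hq0.le hq1).const_mul C).mul_const (2 * r)
  have hunif : TendstoUniformlyOn (fun n : ℕ => T^[n]) (fun _ => p) atTop (ball 0 r) := by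
    rw [Metric.tendstoUniformlyOn_iff]
    intro δ hδ
    have h1 := hgeom.eventually_lt_const hδ
    have h2 : ∀ᶠ n : ℕ in atTop, ∀ y ∈ ball (0 : X) r, dist p (T^[n + 1] y) < δ := by
      filter_upwards [h1] with n hn y hy
      have h3 := hlip n p hpc (T y) (hmc y hy)
      rw [hTnp, ← Function.iterate_succ_apply] at h3
      rw [dist_comm, dist_eq_norm]
      refine (h3.trans ?_).trans_lt hn
      gcongr
      linarith [norm_sub_le (T y) p, hm y hy, mem_closedBall_zero_iff.1 hpc]
    obtain ⟨N, hN⟩ := eventually_atTop.1 h2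
    filter_upwards [eventually_ge_atTop (N + 1)] with n hn y hy
    obtain ⟨m, rfl⟩ : ∃ m, n = m + 1 := ⟨n - 1, by omega⟩
    exact hN m (by omega) y hy
  refine ⟨p, hsub hpc, hTp, fun y hy hTy => ?_, ?_, hunif⟩
  · have h1 := hunif.tendsto_at hy
    simp only [fun n => Function.iterate_fixed hTy n] at h1
    exact tendsto_nhds_unique tendsto_const_nhds h1
  · -- some power of `T'(p)` has norm less than one, and `1 - T'(p)` divides `1 - T'(p)ⁿ`
    set D := fderiv ℂ T p with hD
    have hTD : HasFDerivAt T D p :=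
      (hT.differentiableAt (isOpen_ball.mem_nhds (hsub hpc))).hasFDerivAt
    have hpow : ∀ n, ‖D ^ n‖ ≤ C * q ^ n := fun n => by
      rw [← (hTD.iterate hTp n).fderiv]
      exact (hbound n p hpc).2
    have hsmall : Tendsto (fun n : ℕ => C * q ^ n) atTop (𝓝 0) := by
      simpa using (tendsto_pow_atTop_nhds_zero_of_lt_one hq0.le hq1).const_mul C
    obtain ⟨n, hn⟩ := (hsmall.eventually_lt_const one_pos).exists
    have hu : IsUnit (1 - D ^ n) := isUnit_one_sub_of_norm_lt_one ((hpow n).trans_lt hn)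
    rw [← mul_neg_geom_sum] at hu
    have hcomm : Commute (1 - D) (∑ i ∈ Finset.range n, D ^ i) := by
      apply Commute.sum_right
      intro i _
      exact ((Commute.one_left _).sub_left ((Commute.refl D).pow_right i))
    exact (hcomm.isUnit_mul_iff.1 hu).1

/-! ### Null points of strictly dissipative fields -/

/-- A bounded holomorphic field that points strictly inwards near a sphere has exactly one null
point inside, and its derivative there is invertible: a short Euler step `I + s f` maps the ball
strictly inside itself. -/
theorem exists_unique_null_of_re_le_neg [CompleteSpace X] {f : X → X} {r R α c N : ℝ}
    (hr : 0 < r) (hαr : α < r) (hrR : r < R) (hc : 0 < c)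
    (hf : DifferentiableOn ℂ f (ball 0 R)) (hN : ∀ x ∈ ball (0 : X) R, ‖f x‖ ≤ N)
    (hdis : ∀ x : X, α ≤ ‖x‖ → ‖x‖ < R → ∀ φ : StrongDual ℂ X, ‖φ‖ ≤ 1 → φ x = ‖x‖ →
      (φ (f x)).re ≤ -c) :
    ∃ p ∈ ball (0 : X) r, f p = 0 ∧ (∀ y ∈ ball (0 : X) r, f y = 0 → y = p) ∧
      IsUnit (fderiv ℂ f p) := by
  obtain ⟨R', hrR', hR'R⟩ := exists_between hrR
  have hN0 : 0 ≤ N := (norm_nonneg _).trans (hN 0 (mem_ball_self (by linarith)))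
  set K := 2 * N / (R - R') with hKdef
  have hK0 : 0 ≤ K := div_nonneg (by linarith) (by linarith)
  have hsub : ball (0 : X) R' ⊆ ball 0 R := ball_subset_ball hR'R.le
  have hsubr : ball (0 : X) r ⊆ ball 0 R' := ball_subset_ball hrR'.le
  have hK : ∀ x ∈ ball (0 : X) R', ∀ x' ∈ ball (0 : X) R', ‖f x' - f x‖ ≤ K * ‖x' - x‖ :=
    fun x hx x' hx' => hf.holomorphicAlongCurves.norm_sub_le hR'R hN hx hx'
  -- a step so short that the image stays in the larger ball and the quadratic error is harmless
  obtain ⟨s, hs, hs1, hs2⟩ : ∃ s > 0, s * N ≤ R' - r ∧ K * (s * N) ≤ c / 2 := by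
    have h1 : Tendsto (fun s : ℝ => s * N) (𝓝[>] 0) (𝓝 (0 * N)) :=
      (continuous_id.mul continuous_const).continuousAt.mono_left nhdsWithin_le_nhds
    have h2 := h1.const_mul K
    rw [zero_mul] at h1 h2
    rw [mul_zero] at h2
    obtain ⟨s, hs, hs1, hs2⟩ := (Eventually.and (self_mem_nhdsWithin : Ioi (0 : ℝ) ∈ 𝓝[>] (0 : ℝ))
      ((h1.eventually_lt_const (sub_pos.2 hrR')).and
        (h2.eventually_lt_const (half_pos hc)))).exists
    exact ⟨s, hs, hs1.le, hs2.le⟩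
  set T : X → X := fun x => x + (s : ℂ) • f x with hT
  have hsn : ‖(s : ℂ)‖ = s := by rw [Complex.norm_real, Real.norm_eq_abs, abs_of_pos hs]
  have hTd : DifferentiableOn ℂ T (ball 0 R) := differentiableOn_id.add (hf.const_smul _)
  have hm : ∀ x ∈ ball (0 : X) r, ‖T x‖ ≤ r - min (r - α) (s * (c / 2)) := by
    intro x hx
    have hxr := mem_ball_zero_iff.1 hx
    have hTx : T x ∈ ball (0 : X) R' := by
      rw [mem_ball_zero_iff]
      calc ‖T x‖ ≤ ‖x‖ + s * ‖f x‖ := by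
            refine (norm_add_le _ _).trans ?_
            rw [norm_smul, hsn]
        _ ≤ ‖x‖ + s * N := by gcongr; exact hN x (hsub (hsubr hx))
        _ < R' := by linarith
    rcases le_or_gt α ‖T x‖ with h | h
    · have h1 := norm_add_smul_le (M := -c) hK0 (fun x hx => hN x (hsub hx)) hK (hsubr hx) hTx
        (fun φ hφ hφy => by
          rw [Complex.re_ofReal_mul, hsn]
          exact mul_le_mul_of_nonneg_left
            (hdis _ h (mem_ball_zero_iff.1 (hsub hTx)) φ hφ hφy) hs.le)
      rw [hsn] at h1
      have h2 : s * (-c + K * (s * N)) ≤ s * (-(c / 2)) :=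
        mul_le_mul_of_nonneg_left (by linarith) hs.le
      have h3 := min_le_right (r - α) (s * (c / 2))
      show ‖x + (s : ℂ) • f x‖ ≤ _
      linarith
    · linarith [min_le_left (r - α) (s * (c / 2))]
  have hrsub : ball (0 : X) r ⊆ ball 0 R := ball_subset_ball hrR.le
  obtain ⟨p, hp, hTp, huniq, hunit, -⟩ := exists_fixedPoint_of_mapsTo_smaller_ball
    (lt_min (by linarith) (by positivity)) hr (hTd.mono hrsub) hm
  have hs0 : (s : ℂ) ≠ 0 := by exact_mod_cast hs.ne'
  have hfix : ∀ y, T y = y ↔ f y = 0 := by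
    intro y
    simp [hT, hs.ne']
  refine ⟨p, hp, (hfix p).1 hTp, fun y hy h0 => huniq y hy ((hfix y).2 h0), ?_⟩
  have hfp : HasFDerivAt f (fderiv ℂ f p) p :=
    (hf.differentiableAt (isOpen_ball.mem_nhds (hrsub hp))).hasFDerivAt
  have hTp' : HasFDerivAt T (1 + (s : ℂ) • fderiv ℂ f p) p :=
    (hasFDerivAt_id p).add (hfp.const_smul (s : ℂ))
  rw [hTp'.fderiv, sub_add_cancel_left, ← neg_smul] at hunit
  have := hunit.smul (Units.mk0 (-(s : ℂ)) (neg_ne_zero.2 hs0))⁻¹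
  rwa [Units.smul_def, Units.val_inv_eq_inv_val, Units.val_mk0, smul_smul,
    inv_mul_cancel₀ (neg_ne_zero.2 hs0), one_smul] at this

/-! ### Strict differentiability of holomorphic maps -/

/-- A holomorphic map between complex normed spaces has a continuous derivative, hence is strictly
differentiable. -/
theorem DifferentiableOn.hasStrictFDerivAt_of_isOpen {Y : Type*} [NormedAddCommGroup Y]
    [NormedSpace ℂ Y] {h : X → Y} {U : Set X} (hU : IsOpen U) (hh : DifferentiableOn ℂ h U) {x : X}
    (hx : x ∈ U) : HasStrictFDerivAt h (fderiv ℂ h x) x := by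
  have hdiff : ∀ z ∈ U, HasFDerivAt h (fderiv ℂ h z) z := fun z hz =>
    (hh.differentiableAt (hU.mem_nhds hz)).hasFDerivAt
  apply hasStrictFDerivAt_of_hasFDerivAt_of_continuousAt
  · filter_upwards [hU.mem_nhds hx] with z hz using hdiff z hz
  · obtain ⟨δ, hδ, M, hM, K, hK, hsub, -, hlip⟩ := hh.exists_ball_norm_le_lipschitz hU hx
    -- Cauchy's estimate for the small holomorphic map `z ↦ h (z + (w - x)) - h z`
    have key : ∀ w ∈ ball x (δ / 2),
        ‖fderiv ℂ h w - fderiv ℂ h x‖ ≤ 2 * (K * ‖w - x‖) / (δ / 2) := by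
      intro w hw
      have hw' : ‖w - x‖ < δ / 2 := mem_ball_iff_norm.1 hw
      have hz1 : ∀ z ∈ ball x (δ / 2), z ∈ ball x δ := fun z hz =>
        ball_subset_ball (by linarith) hz
      have hz2 : ∀ z ∈ ball x (δ / 2), z + (w - x) ∈ ball x δ := by
        intro z hz
        rw [mem_ball_iff_norm] at hz ⊢
        calc _ = ‖(z - x) + (w - x)‖ := by congr 1; abel
          _ ≤ _ := norm_add_le _ _
          _ < δ := by linarith
      have hbd : ∀ z ∈ ball x (δ / 2), ‖h (z + (w - x)) - h z‖ ≤ K * ‖w - x‖ := by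
        intro z hz
        have := hlip z (hz1 z hz) _ (hz2 z hz)
        rwa [add_sub_cancel_left] at this
      have hd : ∀ z ∈ ball x (δ / 2), HasFDerivAt (fun z => h (z + (w - x)) - h z)
          (fderiv ℂ h (z + (w - x)) - fderiv ℂ h z) z := fun z hz =>
        ((hasFDerivAt_comp_add_right (w - x)).2 (hdiff _ (hsub (hz2 z hz)))).sub (hdiff _ (hsub (hz1 z hz)))
      have hxm : x ∈ ball x (δ / 2) := mem_ball_self (half_pos hδ)
      have := Complex.norm_fderiv_le_div_of_mapsTo_ball (R₂ := 2 * (K * ‖w - x‖))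
        (fun z hz => (hd z hz).differentiableAt.differentiableWithinAt) (by
          intro z hz
          rw [mem_closedBall, dist_eq_norm]
          exact (norm_sub_le _ _).trans (by linarith [hbd z hz, hbd x hxm])) (half_pos hδ)
      rwa [(hd x hxm).fderiv, add_sub_cancel] at this
    rw [ContinuousAt, tendsto_iff_norm_sub_tendsto_zero]
    refine squeeze_zero' (Eventually.of_forall fun _ => norm_nonneg _)
      (by filter_upwards [ball_mem_nhds x (half_pos hδ)] with w hw using key w hw) ?_
    have : ContinuousAt (fun w => 2 * (K * ‖w - x‖) / (δ / 2)) x := by fun_prop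
    simpa [ContinuousAt] using this

/-! ### The quadratic equation for the critical radius -/

/-- The two roots of the quadratic equation have product `1` when `a > 0`, so that exactly one lies
in `(0, 1)`; for `a = 0` the equation degenerates to `L r = 0`. -/
theorem exists_criticalRadius {a L : ℝ} (ha : 0 ≤ a) (hL : L + 4 * a < 0) :
    ∃ r₁ : ℝ, 0 ≤ r₁ ∧ r₁ < 1 ∧ IsLeast {r : ℝ | a * (1 + r) ^ 2 + L * r = 0} r₁ ∧
      (a ≠ 0 → r₁ = 1 / (2 * a) * (-(2 * a + L) - Real.sqrt ((L + 4 * a) * L))) ∧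
      ∀ ρ ∈ Ioc r₁ 1, a * (1 + ρ) ^ 2 + L * ρ < 0 := by
  rcases ha.eq_or_lt with rfl | hpos
  · have hL' : L < 0 := by linarith
    refine ⟨0, le_rfl, one_pos, ⟨by simp, fun r hr => ?_⟩, fun h => absurd rfl h, fun ρ hρ => ?_⟩
    · have : L * r = 0 := by simpa using hr
      rcases mul_eq_zero.1 this with h | h
      · exact absurd h hL'.ne
      · exact h.ge
    · nlinarith [hρ.1]
  · have hdisc : 0 < (L + 4 * a) * L := mul_pos_of_neg_of_neg hL (by linarith)
    set s := Real.sqrt ((L + 4 * a) * L) with hs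
    have hs0 : 0 < s := Real.sqrt_pos.2 hdisc
    have hs2 : s ^ 2 = (L + 4 * a) * L := Real.sq_sqrt hdisc.le
    set r₁ := 1 / (2 * a) * (-(2 * a + L) - s) with hr₁
    set r₂ := 1 / (2 * a) * (-(2 * a + L) + s) with hr₂
    have hfac : ∀ ρ, a * (1 + ρ) ^ 2 + L * ρ = a * ((ρ - r₁) * (ρ - r₂)) := by
      intro ρ
      have : a * ((ρ - r₁) * (ρ - r₂)) =
          a * ρ ^ 2 + (2 * a + L) * ρ + ((2 * a + L) ^ 2 - s ^ 2) / (4 * a) := by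
        rw [hr₁, hr₂]; field_simp; ring
      rw [this, hs2]; field_simp; ring
    have h12 : r₁ < r₂ := by
      rw [hr₁, hr₂]; gcongr; linarith
    have hneg : (1 - r₁) * (1 - r₂) < 0 := by
      have := hfac 1
      nlinarith
    have hr1 : r₁ < 1 := by
      by_contra! h
      nlinarith [mul_nonneg (sub_nonneg.2 h) (sub_nonneg.2 (h.trans h12.le))]
    have hr2 : 1 < r₂ := by
      by_contra! h
      nlinarith [mul_nonneg (sub_nonneg.2 hr1.le) (sub_nonneg.2 h)]
    have hr0 : 0 ≤ r₁ := by
      have h0 := hfac 0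
      have : r₁ * r₂ = 1 := by
        have h1 : a * (r₁ * r₂) = a * 1 := by linarith
        exact mul_left_cancel₀ hpos.ne' h1
      by_contra! h
      nlinarith
    refine ⟨r₁, hr0, hr1, ⟨by simp [hfac], fun r hr => ?_⟩, fun _ => rfl, fun ρ hρ => ?_⟩
    · have hr' : a * ((r - r₁) * (r - r₂)) = 0 := by rw [← hfac]; exact hr
      rcases mul_eq_zero.1 hr' with h | h
      · exact absurd h hpos.ne'
      · rcases mul_eq_zero.1 h with h | h <;> linarith
    · rw [hfac]
      apply mul_neg_of_pos_of_neg hpos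
      exact mul_neg_of_pos_of_neg (by linarith [hρ.1]) (by linarith [hρ.2])

/-! ### The resolvent -/

theorem resolventMap_spec {h : X → X} {lam : ℂ} {y : X}
    (hex : ∃ x ∈ ball (0 : X) 1, lam • x - h x = lam • y) :
    resolventMap lam h y ∈ ball (0 : X) 1 ∧
      lam • resolventMap lam h y - h (resolventMap lam h y) = lam • y :=
  ⟨Function.invFunOn_mem hex, Function.invFunOn_eq hex⟩

section Resolvent

variable [CompleteSpace X] {h : X → X} {F : ℝ → X → X} {r₁ : ℝ}

theorem IsForwardFlow.exists_re_le_neg (hF : IsForwardFlow h F)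
    (hh : DifferentiableOn ℂ h (ball (0 : X) 1)) (hr₁ : 0 ≤ r₁)
    (hq : ∀ ρ ∈ Ioc r₁ 1, ‖h 0‖ * (1 + ρ) ^ 2 + derivNumSup h * ρ < 0) {α β : ℝ} (hα : r₁ < α)
    (hβ : β < 1) :
    ∃ c > 0, ∀ x : X, α ≤ ‖x‖ → ‖x‖ ≤ β → ∀ φ : StrongDual ℂ X, ‖φ‖ ≤ 1 → φ x = ‖x‖ →
      (φ (h x)).re ≤ -c := by
  rcases lt_or_ge β α with hβα | hαβ
  · exact ⟨1, one_pos, fun x h1 h2 => absurd (h1.trans h2) (not_le.2 hβα)⟩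
  set κ : ℝ → ℝ := fun ρ => (1 - ρ) / (1 + ρ) * (‖h 0‖ * (1 + ρ) ^ 2 + derivNumSup h * ρ) with hκ
  have hc : ContinuousOn κ (Icc α β) := by
    intro ρ hρ
    have : 1 + ρ ≠ 0 := by linarith [hρ.1]
    exact ContinuousAt.continuousWithinAt (by fun_prop (disch := assumption))
  obtain ⟨ρ, hρ, hmax⟩ := isCompact_Icc.exists_isMaxOn (nonempty_Icc.2 hαβ) hc
  have hneg : κ ρ < 0 := mul_neg_of_pos_of_neg
    (div_pos (by linarith [hρ.2]) (by linarith [hρ.1]))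
    (hq ρ ⟨hα.trans_le hρ.1, by linarith [hρ.2]⟩)
  refine ⟨-κ ρ, by linarith, fun x h1 h2 φ hφ hφx => ?_⟩
  rw [neg_neg]
  exact (hF.re_le hh (by linarith) hφ hφx).trans (hmax ⟨h1, h2⟩)

/-- Solvability of `h(x) = λ (x - y)` for `λ ≥ 0`; the case `λ = 0` is the null point equation. -/
theorem IsForwardFlow.exists_unique_resolvent (hF : IsForwardFlow h F)
    (hh : DifferentiableOn ℂ h (ball (0 : X) 1)) (hr₁ : 0 ≤ r₁) (hr₁1 : r₁ < 1)
    (hq : ∀ ρ ∈ Ioc r₁ 1, ‖h 0‖ * (1 + ρ) ^ 2 + derivNumSup h * ρ < 0) {lam : ℝ}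
    (hlam : 0 ≤ lam) {y : X} (hy : y ∈ ball (0 : X) 1) :
    ∃ p ∈ ball (0 : X) 1, h p = (lam : ℂ) • (p - y) ∧
      (∀ x ∈ ball (0 : X) 1, h x = (lam : ℂ) • (x - y) → x = p) ∧ ‖p‖ ≤ max r₁ ‖y‖ ∧
      IsUnit ((lam : ℂ) • 1 - fderiv ℂ h p) := by
  have hy1 : ‖y‖ < 1 := mem_ball_zero_iff.1 hy
  set f : X → X := fun x => h x - (lam : ℂ) • (x - y) with hf
  have hfd : DifferentiableOn ℂ f (ball 0 1) :=
    hh.sub ((differentiableOn_id.sub_const y).const_smul _)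
  have hf0 : ∀ x, f x = 0 ↔ h x = (lam : ℂ) • (x - y) := fun x => sub_eq_zero
  have key : ∀ r, max r₁ ‖y‖ < r → r < 1 → ∃ p ∈ ball (0 : X) r, f p = 0 ∧
      (∀ x ∈ ball (0 : X) r, f x = 0 → x = p) ∧ IsUnit (fderiv ℂ f p) := by
    intro r hr1 hr2
    obtain ⟨α, hα1, hα2⟩ := exists_between hr1
    obtain ⟨R, hrR, hR1⟩ := exists_between hr2
    have hr₁α : r₁ < α := (le_max_left _ _).trans_lt hα1
    have hyα : ‖y‖ < α := (le_max_right _ _).trans_lt hα1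
    obtain ⟨c, hc, hdis⟩ := hF.exists_re_le_neg hh hr₁ hq hr₁α hR1
    obtain ⟨C, hC, hbd⟩ := hF.exists_norm_le hh (by linarith) hR1
    refine exists_unique_null_of_re_le_neg (α := α) (N := C + lam * (1 + 1)) (by linarith) hα2 hrR
      hc (hfd.mono (ball_subset_ball hR1.le)) ?_ ?_
    · intro x hx
      have hx1 := mem_ball_zero_iff.1 hx
      refine (norm_sub_le _ _).trans (add_le_add (hbd x hx) ?_)
      rw [norm_smul, Complex.norm_real, Real.norm_eq_abs, abs_of_nonneg hlam]
      gcongr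
      exact (norm_sub_le _ _).trans (by linarith)
    · intro x hx1 hx2 φ hφ hφx
      have h1 := hdis x hx1 hx2.le φ hφ hφx
      have h2 : (φ y).re ≤ ‖y‖ := (Complex.re_le_norm _).trans
        ((φ.le_opNorm y).trans (mul_le_of_le_one_left (norm_nonneg _) hφ))
      rw [hf, map_sub, map_smul, map_sub, hφx, Complex.sub_re, smul_eq_mul, Complex.re_ofReal_mul,
        Complex.sub_re, Complex.ofReal_re]
      nlinarith
  have hm1 : max r₁ ‖y‖ < 1 := max_lt hr₁1 hy1
  obtain ⟨r, hr1, hr2⟩ := exists_between hm1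
  obtain ⟨p, hp, hfp, -, hunit⟩ := key r hr1 hr2
  have hp1 : p ∈ ball (0 : X) 1 := ball_subset_ball hr2.le hp
  have huniq : ∀ x ∈ ball (0 : X) 1, f x = 0 → x = p := by
    intro x hx hfx
    obtain ⟨s, hs1, hs2⟩ := exists_between
      (max_lt (max_lt hm1 (mem_ball_zero_iff.1 hx)) (mem_ball_zero_iff.1 hp1))
    obtain ⟨p', -, -, hu, -⟩ := key s
      (((le_max_left _ _).trans (le_max_left _ _)).trans_lt hs1) hs2
    rw [hu x (mem_ball_zero_iff.2 (((le_max_right _ _).trans (le_max_left _ _)).trans_lt hs1)) hfx,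
      hu p (mem_ball_zero_iff.2 ((le_max_right _ _).trans_lt hs1)) hfp]
  refine ⟨p, hp1, (hf0 p).1 hfp, fun x hx hx' => huniq x hx ((hf0 x).2 hx'), ?_, ?_⟩
  · by_contra! hlt
    obtain ⟨s, hs1, hs2⟩ := exists_between hlt
    have hs3 : s < 1 := hs2.trans (mem_ball_zero_iff.1 hp1)
    obtain ⟨p', hp', hfp', -⟩ := key s hs1 hs3
    rw [huniq p' (ball_subset_ball hs3.le hp') hfp'] at hp'
    exact absurd (mem_ball_zero_iff.1 hp') (not_lt.2 hs2.le)
  · have h1 : HasFDerivAt f (fderiv ℂ h p - (lam : ℂ) • 1) p :=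
      (hh.differentiableAt (isOpen_ball.mem_nhds hp1)).hasFDerivAt.sub
        (((hasFDerivAt_id p).sub_const y).const_smul (lam : ℂ))
    rw [h1.fderiv] at hunit
    simpa using hunit.neg

theorem IsForwardFlow.existsUnique_resolvent_equation (hF : IsForwardFlow h F)
    (hh : DifferentiableOn ℂ h (ball (0 : X) 1)) (hr₁ : 0 ≤ r₁) (hr₁1 : r₁ < 1)
    (hq : ∀ ρ ∈ Ioc r₁ 1, ‖h 0‖ * (1 + ρ) ^ 2 + derivNumSup h * ρ < 0) {lam : ℝ}
    (hlam : 0 ≤ lam) {y : X} (hy : y ∈ ball (0 : X) 1) :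
    ∃! x : X, x ∈ ball (0 : X) 1 ∧ (lam : ℂ) • x - h x = (lam : ℂ) • y := by
  have heq : ∀ x, (lam : ℂ) • x - h x = (lam : ℂ) • y ↔ h x = (lam : ℂ) • (x - y) := by
    intro x
    rw [smul_sub, sub_eq_iff_eq_add, eq_sub_iff_add_eq, eq_comm, add_comm]
  obtain ⟨p, hp, hp1, hp2, -⟩ := hF.exists_unique_resolvent hh hr₁ hr₁1 hq hlam hy
  exact ⟨p, ⟨hp, (heq p).2 hp1⟩, fun x hx => hp2 x hx.1 ((heq x).1 hx.2)⟩

/-- Properties of the value `Φ_λ(y)` of the resolvent mapping. -/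
theorem IsForwardFlow.resolventMap_properties (hF : IsForwardFlow h F)
    (hh : DifferentiableOn ℂ h (ball (0 : X) 1)) (hr₁ : 0 ≤ r₁) (hr₁1 : r₁ < 1)
    (hq : ∀ ρ ∈ Ioc r₁ 1, ‖h 0‖ * (1 + ρ) ^ 2 + derivNumSup h * ρ < 0) {lam : ℝ}
    (hlam : 0 ≤ lam) {y : X} (hy : y ∈ ball (0 : X) 1) :
    resolventMap (lam : ℂ) h y ∈ ball (0 : X) 1 ∧
      h (resolventMap (lam : ℂ) h y) = (lam : ℂ) • (resolventMap (lam : ℂ) h y - y) ∧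
      (∀ x ∈ ball (0 : X) 1, h x = (lam : ℂ) • (x - y) → x = resolventMap (lam : ℂ) h y) ∧
      ‖resolventMap (lam : ℂ) h y‖ ≤ max r₁ ‖y‖ ∧
      IsUnit ((lam : ℂ) • 1 - fderiv ℂ h (resolventMap (lam : ℂ) h y)) := by
  have hex := hF.existsUnique_resolvent_equation hh hr₁ hr₁1 hq hlam hy
  obtain ⟨h1, h2⟩ := resolventMap_spec hex.exists
  obtain ⟨p, hp, hp1, hp2, hp3, hp4⟩ := hF.exists_unique_resolvent hh hr₁ hr₁1 hq hlam hy
  have h3 : resolventMap (lam : ℂ) h y = p := hp2 _ h1 (by rw [smul_sub, ← h2]; abel)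
  rw [h3]
  exact ⟨hp, hp1, hp2, hp3, hp4⟩

/-- The resolvent mapping is holomorphic, by the inverse function theorem for `λ I - h`. -/
theorem IsForwardFlow.differentiableOn_resolventMap (hF : IsForwardFlow h F)
    (hh : DifferentiableOn ℂ h (ball (0 : X) 1)) (hr₁ : 0 ≤ r₁) (hr₁1 : r₁ < 1)
    (hq : ∀ ρ ∈ Ioc r₁ 1, ‖h 0‖ * (1 + ρ) ^ 2 + derivNumSup h * ρ < 0) {lam : ℝ}
    (hlam : 0 ≤ lam) : DifferentiableOn ℂ (resolventMap (lam : ℂ) h) (ball (0 : X) 1) := by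
  intro y hy
  apply DifferentiableAt.differentiableWithinAt
  obtain ⟨hp, hp1, -, -, hunit⟩ := hF.resolventMap_properties hh hr₁ hr₁1 hq hlam hy
  set p := resolventMap (lam : ℂ) h y
  set G : X → X := fun x => (lam : ℂ) • x - h x with hG
  obtain ⟨e, he⟩ : ∃ e : X ≃L[ℂ] X, (e : X →L[ℂ] X) = (lam : ℂ) • 1 - fderiv ℂ h p :=
    ⟨ContinuousLinearEquiv.ofUnit hunit.unit, by ext; rfl⟩
  have hstrict : HasStrictFDerivAt G (e : X →L[ℂ] X) p := by
    rw [he]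
    exact ((hasStrictFDerivAt_id p).const_smul (lam : ℂ)).sub
      (hh.hasStrictFDerivAt_of_isOpen isOpen_ball hp)
  have hGp : G p = (lam : ℂ) • y := by
    simp only [hG, hp1, smul_sub]; abel
  set g := hstrict.localInverse G e p
  have hginv := hstrict.to_localInverse
  have hright := hstrict.eventually_right_inverse
  have hgp : g (G p) = p := hstrict.localInverse_apply_image
  rw [hGp] at hginv hright hgp
  have hlin : ContinuousAt (fun y' : X => (lam : ℂ) • y') y := by fun_prop
  have hgc : ContinuousAt (fun y' : X => g ((lam : ℂ) • y')) y :=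
    ContinuousAt.comp (f := fun y' : X => (lam : ℂ) • y') (g := g)
      hginv.hasFDerivAt.continuousAt hlin
  have hball : ∀ᶠ y' in 𝓝 y, g ((lam : ℂ) • y') ∈ ball (0 : X) 1 := by
    apply hgc.eventually_mem
    rw [hgp]
    exact isOpen_ball.mem_nhds hp
  have hev : resolventMap (lam : ℂ) h =ᶠ[𝓝 y] fun y' => g ((lam : ℂ) • y') := by
    filter_upwards [isOpen_ball.mem_nhds hy, hball, hlin.eventually hright] with y' h1 h2 h3
    refine ((hF.resolventMap_properties hh hr₁ hr₁1 hq hlam h1).2.2.1 _ h2 ?_).symm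
    have h4 : (lam : ℂ) • g ((lam : ℂ) • y') - h (g ((lam : ℂ) • y')) = (lam : ℂ) • y' := h3
    rw [smul_sub, eq_sub_iff_add_eq]
    exact (sub_eq_iff_eq_add'.1 h4).symm
  refine DifferentiableAt.congr_of_eventuallyEq ?_ hev
  exact DifferentiableAt.comp (f := fun y' : X => (lam : ℂ) • y') (g := g) y
    hginv.hasFDerivAt.differentiableAt (by fun_prop)

/-- For `λ > 0` the resolvent mapping sends each ball of radius `r ∈ (r₁, 1)` into a strictly
smaller one, so the Earle–Hamilton theorem applies to it. -/
theorem IsForwardFlow.tendstoUniformlyOn_iterate_resolventMap (hF : IsForwardFlow h F)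
    (hh : DifferentiableOn ℂ h (ball (0 : X) 1)) (hr₁ : 0 ≤ r₁) (hr₁1 : r₁ < 1)
    (hq : ∀ ρ ∈ Ioc r₁ 1, ‖h 0‖ * (1 + ρ) ^ 2 + derivNumSup h * ρ < 0) {lam : ℝ}
    (hlam : 0 < lam) {x₀ : X} (hx₀ : ‖x₀‖ ≤ r₁) (hx₀h : h x₀ = 0) {ρ : ℝ} (hρ : ρ < 1) :
    TendstoUniformlyOn (fun n : ℕ => (resolventMap (lam : ℂ) h)^[n]) (fun _ => x₀) atTop
      (ball (0 : X) ρ) := by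
  obtain ⟨r, hr, hr1⟩ := exists_between (max_lt hr₁1 hρ)
  have hr₁r : r₁ < r := (le_max_left _ _).trans_lt hr
  have hρr : ρ < r := (le_max_right _ _).trans_lt hr
  obtain ⟨α, hα, hαr⟩ := exists_between hr₁r
  obtain ⟨c, hc, hdis⟩ := hF.exists_re_le_neg hh hr₁ hq hα hr1
  have hsub : ball (0 : X) r ⊆ ball 0 1 := ball_subset_ball hr1.le
  have hm : ∀ y ∈ ball (0 : X) r, ‖resolventMap (lam : ℂ) h y‖ ≤ r - min (r - α) (c / lam) := by
    intro y hy
    obtain ⟨-, hp1, -, hp2, -⟩ := hF.resolventMap_properties hh hr₁ hr₁1 hq hlam.le (hsub hy)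
    have hyr := mem_ball_zero_iff.1 hy
    set p := resolventMap (lam : ℂ) h y
    rcases le_or_gt α ‖p‖ with h1 | h1
    · obtain ⟨φ, hφ, hφp⟩ := exists_dual_vector'' ℂ p
      have hφp' : φ p = ((‖p‖ : ℝ) : ℂ) := hφp
      have h2 := hdis p h1 (hp2.trans (max_le hr₁r.le hyr.le)) φ hφ hφp
      have h3 : (φ y).re ≤ ‖y‖ := (Complex.re_le_norm _).trans
        ((φ.le_opNorm y).trans (mul_le_of_le_one_left (norm_nonneg _) hφ))
      rw [hp1, map_smul, map_sub, hφp', smul_eq_mul, Complex.re_ofReal_mul,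
        Complex.sub_re, Complex.ofReal_re] at h2
      have h4 : ‖p‖ - (φ y).re ≤ -c / lam := by
        rw [le_div_iff₀ hlam]; linarith
      rw [neg_div] at h4
      linarith [min_le_right (r - α) (c / lam)]
    · linarith [min_le_left (r - α) (c / lam)]
  obtain ⟨p, -, -, huniq, -, hunif⟩ := exists_fixedPoint_of_mapsTo_smaller_ball
    (lt_min (by linarith) (by positivity)) (by linarith)
    ((hF.differentiableOn_resolventMap hh hr₁ hr₁1 hq hlam.le).mono hsub) hm
  have hx₀r : x₀ ∈ ball (0 : X) r := by rw [mem_ball_zero_iff]; linarith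
  have hfix : resolventMap (lam : ℂ) h x₀ = x₀ :=
    ((hF.resolventMap_properties hh hr₁ hr₁1 hq hlam.le (hsub hx₀r)).2.2.1 x₀ (hsub hx₀r)
      (by simp [hx₀h])).symm
  rw [huniq x₀ hx₀r hfix]
  exact hunif.mono (ball_subset_ball hρr.le)

end Resolvent

/-! ### Invariance of the balls between the critical radius and the unit sphere -/

/-- The growth estimate is dominated by `-L (r - ‖x‖)` inside the ball as soon as the quadratic
expression is nonpositive at `r`. -/
theorem IsForwardFlow.isSemiComplete_ball_of_quadratic_nonpos [CompleteSpace X] {h : X → X}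
    {F : ℝ → X → X} (hF : IsForwardFlow h F) (hh : DifferentiableOn ℂ h (ball (0 : X) 1)) {r : ℝ}
    (hr1 : r ≤ 1) (hq : ‖h 0‖ * (1 + r) ^ 2 + derivNumSup h * r ≤ 0) :
    IsSemiComplete (-h) (ball (0 : X) r) := by
  refine hF.isSemiComplete_ball (C := -derivNumSup h) hr1 fun x hx φ hφ hφx => ?_
  refine (hF.re_le hh (hx.trans_le hr1) hφ hφx).trans ?_
  have hL := hF.derivNumSup_nonpos hh
  have hρ := norm_nonneg x
  have ha := norm_nonneg (h 0)
  set ρ := ‖x‖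
  set a := ‖h 0‖
  set L := derivNumSup h
  have h1 : a * (1 + ρ) ^ 2 + L * ρ ≤ -L * (r - ρ) := by
    have : (1 + ρ) ^ 2 ≤ (1 + r) ^ 2 := by gcongr
    nlinarith [mul_le_mul_of_nonneg_left this ha]
  have h2 : 0 ≤ (1 - ρ) / (1 + ρ) := div_nonneg (by linarith) (by linarith)
  have h3 : (1 - ρ) / (1 + ρ) ≤ 1 := (div_le_one (by linarith)).2 (by linarith)
  have h4 : 0 ≤ -L * (r - ρ) := mul_nonneg (by linarith) (by linarith)
  calc _ ≤ (1 - ρ) / (1 + ρ) * (-L * (r - ρ)) := mul_le_mul_of_nonneg_left h1 h2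
    _ ≤ 1 * (-L * (r - ρ)) := mul_le_mul_of_nonneg_right h3 h4
    _ = _ := one_mul _

end

/-! ### Semi-complete holomorphic fields with a dissipative linear part -/

theorem mainTheorem7 {X : Type*} [NormedAddCommGroup X] [NormedSpace ℂ X] [CompleteSpace X]
    (h : X → X) (hh : DifferentiableOn ℂ h (Metric.ball (0 : X) 1))
    (hsc : IsSemiComplete (-h) (Metric.ball (0 : X) 1)) :
    derivNumSup h ≤ 0 ∧
    (∀ R : ℝ, 0 < R → IsSemiComplete (-(fderiv ℂ h 0 : X → X)) (Metric.ball (0 : X) R)) ∧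
    (derivNumSup h + 4 * ‖h 0‖ < 0 →
      ∃ r₁ : ℝ, 0 ≤ r₁ ∧ r₁ < 1 ∧
        IsLeast {r : ℝ | ‖h 0‖ * (1 + r) ^ 2 + derivNumSup h * r = 0} r₁ ∧
        (h 0 ≠ 0 → r₁ = 1 / (2 * ‖h 0‖) * (-(2 * ‖h 0‖ + derivNumSup h)
          - Real.sqrt ((derivNumSup h + 4 * ‖h 0‖) * derivNumSup h))) ∧
        (∀ r ∈ Set.Icc r₁ 1, IsSemiComplete (-h) (Metric.ball (0 : X) r)) ∧
        ∃ x₀ ∈ Metric.ball (0 : X) 1, h x₀ = 0 ∧ ‖x₀‖ ≤ r₁ ∧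
          (∀ y ∈ Metric.ball (0 : X) 1, h y = 0 → y = x₀) ∧
          ∀ lam : ℝ, 0 < lam →
            (∀ y ∈ Metric.ball (0 : X) 1,
              ∃! x : X, x ∈ Metric.ball (0 : X) 1 ∧ (lam : ℂ) • x - h x = (lam : ℂ) • y) ∧
            Set.MapsTo (resolventMap (lam : ℂ) h) (Metric.ball (0 : X) 1)
              (Metric.ball (0 : X) 1) ∧
            DifferentiableOn ℂ (resolventMap (lam : ℂ) h) (Metric.ball (0 : X) 1) ∧
            ∀ ρ : ℝ, ρ < 1 →
              TendstoUniformlyOn (fun n : ℕ => (resolventMap (lam : ℂ) h)^[n]) (fun _ => x₀)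
                Filter.atTop (Metric.ball (0 : X) ρ)) := by
  obtain ⟨F, hF⟩ := hsc.exists_isForwardFlow
  refine ⟨hF.derivNumSup_nonpos hh, fun R _ =>
    (fderiv ℂ h 0).isSemiComplete_of_re_nonpos
      (fun u hu φ hφ hφu => hF.re_fderiv_nonpos hh hu hφ hφu) R, fun hL => ?_⟩
  obtain ⟨r₁, hr₁, hr₁1, hleast, hform, hq⟩ := exists_criticalRadius (norm_nonneg (h 0)) hL
  obtain ⟨x₀, hx₀, hx₀h, huniq, hx₀n, -⟩ :=
    hF.exists_unique_resolvent hh hr₁ hr₁1 hq le_rfl (mem_ball_self one_pos)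
  simp only [Complex.ofReal_zero, zero_smul, norm_zero, max_eq_left hr₁] at hx₀h huniq hx₀n
  refine ⟨r₁, hr₁, hr₁1, hleast, fun h0 => hform (norm_ne_zero_iff.2 h0), ?_, x₀, hx₀, hx₀h, hx₀n,
    huniq, fun lam hlam => ⟨?_, ?_, ?_, ?_⟩⟩
  · intro r hr
    refine hF.isSemiComplete_ball_of_quadratic_nonpos hh hr.2 ?_
    rcases hr.1.eq_or_lt with rfl | hlt
    · exact le_of_eq hleast.1
    · exact (hq r ⟨hlt, hr.2⟩).le
  · exact fun y hy => hF.existsUnique_resolvent_equation hh hr₁ hr₁1 hq hlam.le hy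
  · exact fun y hy => (hF.resolventMap_properties hh hr₁ hr₁1 hq hlam.le hy).1
  · exact hF.differentiableOn_resolventMap hh hr₁ hr₁1 hq hlam.le
  · exact fun ρ hρ => hF.tendstoUniformlyOn_iterate_resolventMap hh hr₁ hr₁1 hq hlam hx₀n hx₀h hρ
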